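/- Let $F$ be a field of characteristic not two or three. Let $\mathfrak{gl}(1,2)$ be the Lie superalgebra of $3\times 3$ matrices over $F$ (first basis vector of $F^{1|2}$ even, the other two odd), let $$\mathfrak b=\mathfrak{osp}(1,2)=\left\{\begin{pmatrix}0&\mu&\nu\\-\nu&\alpha&\beta\\ \mu&\gamma&-\alpha\end{pmatrix}:\alpha,\beta,\gamma,\mu,\nu\in F\right\}\subset\mathfrak{gl}(1,2),\qquad H=\begin{pmatrix}0&0&0\\0&1&0\\0&0&-1\end{pmatrix},\quad X=\begin{pmatrix}0&0&-1\\1&0&0\\0&0&0\end{pmatrix}\in\mathfrak b,$$ let $$\mathfrak s=\left\{\begin{pmatrix}2\alpha&\mu&\nu\\ \nu&\alpha&0\\-\mu&0&\alpha\end{pmatrix}:\alpha,\mu,\nu\in F\right\}\subset\mathfrak{gl}(1,2),$$ a $\mathfrak b$-module under the bracket, isomorphic to the natural module $F^{1|2}$, and let $\Phi$ be conjugation by $\begin{pmatrix}1&0&0\\0&0&-1\\0&1&0\end{pmatrix}$, which preserves $\mathfrak b$ and $\mathfrak s$. Let $\mathfrak g$ be a strictly $B(0,1)$-graded Lie superalgebra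 over $F$: $\mathfrak g$ (of any dimension) contains a subalgebra isomorphic to $\mathfrak b$ (fix such an isomorphism) and, as a module for it, is a sum of copies of the adjoint module and of the natural module, all with their natural parity, and of a submodule with trivial action. Then: 1. There are vector spaces $A$, $B$ and a decomposition of $\mathfrak b$-modules, compatible with the parities, $\mathfrak g=(\mathfrak b\otimes A)\oplus(\mathfrak s\otimes B)\oplus D$, where $A$ and $B$ have no odd part and $D$ is the centralizer in $\mathfrak g$ of the given subalgebra. 2. The subspaces $\mathfrak g_i=\{z\in\mathfrak g:[H,z]=iz\}$, $-2\le i\le 2$, where $H$ is viewed in $\mathfrak g$ through the given isomorphism, form a $5$-grading: $\mathfrak g=\bigoplus_{i=-2}^{2}\mathfrak g_i$ and $[\mathfrak g_i,\mathfrak g_j]\subseteq\mathfrak g_{i+j}$ (with $\mathfrak g_k=0$ for $|k|>2$). 3. For every decomposition as in 1, there is an element $1\in A$ such that the given subalgebra is identified with $\mathfrak b\otimes 1$, each $m\in\mathfrak b$ corresponding to $m\otimes 1$. The linear map $\Phi$ of $\mathfrak g$ given by $m\otimes a\mapsto\Phi(m)\otimes a$ on $\mathfrak b\otimes A$, $s\otimes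 b\mapsto\Phi(s)\otimes b$ on $\mathfrak s\otimes B$ and the identity on $D$ is an automorphism of the Lie superalgebra $\mathfrak g$. The formula $xyz=[[x,\Phi(y)],z]$ defines a trilinear product on $U=\mathfrak g_1$ with which $U$ is a $(-1,-1)$ Freudenthal–Kantor triple system; that is, with $L(x,y)z=xyz$ and $K(x,y)z=xzy+yzx$, $$[L(u,v),L(x,y)]=L(uvx,y)-L(x,vuy),\qquad K(K(u,v)x,y)=L(y,x)K(u,v)+K(u,v)L(x,y)$$ for all $u,v,x,y\in U$. The element $e=X\otimes 1$ lies in $U$, is a left unit, i.e. $eex=x$ for all $x\in U$, and satisfies $exe=x$ for all $x\in U$. -/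

import Mathlib

open scoped TensorProduct

universe u v a b

/-! ### Lie superalgebras -/

/-- The sign `(-1)^(i j)` attached to two parities. -/
def superSign (F : Type*) [Field F] (i j : ZMod 2) : F :=
  if i = 1 ∧ j = 1 then -1 else 1

/-- A Lie superalgebra structure on a vector space `g` over a field of characteristic different
from two and three (in characteristics two and three further axioms would be needed): a splitting
into an even part `homog 0` and an odd part `homog 1`, with a bilinear bracket compatible with it
that is super-anticommutative and satisfies the super Jacobi identity. -/
structure LieSuperalgebra (F : Type u) (g : Type v) [Field F] [AddCommGroup g] [Module F g] where
  homog : ZMod 2 → Submodule F g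
  isCompl : IsCompl (homog 0) (homog 1)
  bracket : g →ₗ[F] g →ₗ[F] g
  bracket_mem : ∀ (i j : ZMod 2) (x y : g), x ∈ homog i → y ∈ homog j →
    bracket x y ∈ homog (i + j)
  skew : ∀ (i j : ZMod 2) (x y : g), x ∈ homog i → y ∈ homog j →
    bracket x y = -(superSign F i j • bracket y x)
  jacobi : ∀ (i j : ZMod 2) (x y z : g), x ∈ homog i → y ∈ homog j →
    bracket x (bracket y z) = bracket (bracket x y) z + superSign F i j • bracket y (bracket x z)

namespace LieSuperalgebra

variable {F : Type*} [Field F] {g h : Type*} [AddCommGroup g] [Module F g]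
  [AddCommGroup h] [Module F h]

/-- Homomorphisms of Lie superalgebras: linear, preserving the parity and the bracket. -/
structure IsHom (L : LieSuperalgebra F g) (M : LieSuperalgebra F h) (f : g →ₗ[F] h) : Prop where
  map_homog : ∀ (i : ZMod 2) (x : g), x ∈ L.homog i → f x ∈ M.homog i
  map_bracket : ∀ x y : g, f (L.bracket x y) = M.bracket (f x) (f y)

/-- Automorphisms of a Lie superalgebra. -/
def IsAutomorphism (L : LieSuperalgebra F g) (f : g →ₗ[F] g) : Prop :=
  L.IsHom L f ∧ Function.Bijective f

/-- A Lie subsuperalgebra: a graded subspace closed under the bracket. -/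
structure IsSubalgebra (L : LieSuperalgebra F g) (S : Submodule F g) : Prop where
  graded : S ≤ (S ⊓ L.homog 0) ⊔ (S ⊓ L.homog 1)
  bracket_mem : ∀ x ∈ S, ∀ y ∈ S, L.bracket x y ∈ S

/-- The Lie superalgebra structure induced on a Lie subsuperalgebra. -/
def restrict (L : LieSuperalgebra F g) (S : Submodule F g) (hS : L.IsSubalgebra S) :
    LieSuperalgebra F S where
  homog i := (L.homog i).comap S.subtype
  isCompl := by
    constructor
    · rw [Submodule.disjoint_def]
      intro x h0 h1
      exact Subtype.ext ((Submodule.disjoint_def.1 L.isCompl.disjoint) x.1 h0 h1)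
    · rw [codisjoint_iff, eq_top_iff]
      rintro ⟨x, hx⟩ -
      obtain ⟨y, hy, z, hz, e⟩ := Submodule.mem_sup.1 (hS.graded hx)
      exact Submodule.mem_sup.2 ⟨⟨y, hy.1⟩, hy.2, ⟨z, hz.1⟩, hz.2, Subtype.ext e⟩
  bracket := LinearMap.mk₂ F (fun x y => ⟨L.bracket x.1 y.1, hS.bracket_mem _ x.2 _ y.2⟩)
    (fun x y z => Subtype.ext (by simp)) (fun c x y => Subtype.ext (by simp))
    (fun x y z => Subtype.ext (by simp)) (fun c x y => Subtype.ext (by simp))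
  bracket_mem i j x y hx hy := L.bracket_mem i j x.1 y.1 hx hy
  skew i j x y hx hy := Subtype.ext (L.skew i j x.1 y.1 hx hy)
  jacobi i j x y z hx hy := Subtype.ext (L.jacobi i j x.1 y.1 z.1 hx hy)

/-- A family `G : ℤ → Submodule F g` is a `5`-grading of the Lie superalgebra if `g` is the
(internal) direct sum of the `G i`, `[G i, G j] ⊆ G (i + j)`, and `G i = 0` unless
`-2 ≤ i ≤ 2`. -/
structure IsFiveGrading (L : LieSuperalgebra F g) (G : ℤ → Submodule F g) : Prop where
  isInternal : DirectSum.IsInternal G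
  bracket_mem : ∀ (i j : ℤ) (x y : g), x ∈ G i → y ∈ G j → L.bracket x y ∈ G (i + j)
  eq_bot : ∀ i : ℤ, ¬(-2 ≤ i ∧ i ≤ 2) → G i = ⊥

/-- The family `g_i = {z | [h, z] = i z}` for `-2 ≤ i ≤ 2` (and `g_i = 0` for the other `i`). -/
def adGrade (L : LieSuperalgebra F g) (h : g) (i : ℤ) : Submodule F g :=
  if -2 ≤ i ∧ i ≤ 2 then LinearMap.ker (L.bracket h - (i : F) • LinearMap.id) else ⊥

end LieSuperalgebra

/-! ### The general linear Lie superalgebra -/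

section GeneralLinear

variable {F : Type*} [Field F] {n : Type*}

/-- Matrices of parity `i`, when the index `r` has parity `p r`: the entry at `(r, c)` has parity
`p r + p c`. -/
def glHomog (F : Type*) [Field F] {n : Type*} (p : n → ZMod 2) (i : ZMod 2) :
    Submodule F (Matrix n n F) where
  carrier := {M | ∀ r c, p r + p c ≠ i → M r c = 0}
  zero_mem' := fun _ _ _ => rfl
  add_mem' := by
    intro M N hM hN r c h
    simp [hM r c h, hN r c h]
  smul_mem' := by
    intro t M hM r c h
    simp [hM r c h]

/-- The odd component of a matrix. -/
def glOdd (F : Type*) [Field F] {n : Type*} (p : n → ZMod 2) :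
    Matrix n n F →ₗ[F] Matrix n n F where
  toFun M := Matrix.of fun r c => if p r + p c = 1 then M r c else 0
  map_add' M N := by ext r c; by_cases h : p r + p c = 1 <;> simp [h]
  map_smul' t M := by ext r c; by_cases h : p r + p c = 1 <;> simp [h]

/-- The supercommutator: the bilinear product with `[M, N] = M N - N M` when `M` or `N` is even
and `[M, N] = M N + N M` when both are odd. -/
def glBracket (F : Type*) [Field F] {n : Type*} [Fintype n] (p : n → ZMod 2) :
    Matrix n n F →ₗ[F] Matrix n n F →ₗ[F] Matrix n n F :=
  LinearMap.mk₂ F (fun M N => M * N - N * M + (2 : F) • (glOdd F p N * glOdd F p M))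
    (fun M N K => by simp only [map_add, add_mul, mul_add, smul_add]; abel)
    (fun t M N => by
      simp only [map_smul, smul_mul_assoc, mul_smul_comm, smul_add, smul_sub, smul_comm t])
    (fun M N K => by simp only [map_add, add_mul, mul_add, smul_add]; abel)
    (fun t M N => by
      simp only [map_smul, smul_mul_assoc, mul_smul_comm, smul_add, smul_sub, smul_comm t])

theorem zmodTwo_cases (i : ZMod 2) : i = 0 ∨ i = 1 := by
  revert i; decide

theorem glOdd_of_even (p : n → ZMod 2) {M : Matrix n n F} (hM : M ∈ glHomog F p 0) :
    glOdd F p M = 0 := by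
  ext r c
  by_cases h : p r + p c = 1
  · have : M r c = 0 := hM r c (by rw [h]; decide)
    simp [glOdd, this]
  · simp [glOdd, h]

theorem glOdd_of_odd (p : n → ZMod 2) {M : Matrix n n F} (hM : M ∈ glHomog F p 1) :
    glOdd F p M = M := by
  ext r c
  by_cases h : p r + p c = 1
  · simp [glOdd, h]
  · simp [glOdd, h, hM r c h]

theorem glBracket_apply [Fintype n] (p : n → ZMod 2) (M N : Matrix n n F) :
    glBracket F p M N = M * N - N * M + (2 : F) • (glOdd F p N * glOdd F p M) := rfl

theorem glBracket_eq [Fintype n] (p : n → ZMod 2) {i j : ZMod 2} {M N : Matrix n n F}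
    (hM : M ∈ glHomog F p i) (hN : N ∈ glHomog F p j) :
    glBracket F p M N = M * N - superSign F i j • (N * M) := by
  rw [glBracket_apply]
  rcases zmodTwo_cases i with rfl | rfl <;> rcases zmodTwo_cases j with rfl | rfl
  · simp [glOdd_of_even p hM, superSign]
  · simp [glOdd_of_even p hM, superSign]
  · simp [glOdd_of_even p hN, superSign]
  · simp only [glOdd_of_odd p hM, glOdd_of_odd p hN, superSign, and_self, if_true, two_smul,
      neg_smul, one_smul]
    abel

theorem glHomog_mul [Fintype n] (p : n → ZMod 2) {i j : ZMod 2} {M N : Matrix n n F}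
    (hM : M ∈ glHomog F p i) (hN : N ∈ glHomog F p j) : M * N ∈ glHomog F p (i + j) := by
  intro r c h
  rw [Matrix.mul_apply]
  refine Finset.sum_eq_zero fun k _ => ?_
  by_cases h1 : p r + p k = i
  · have h2 : p k + p c ≠ j := by
      intro h2
      apply h
      rw [← h1, ← h2]
      generalize p r = x, p k = y, p c = z
      revert x y z
      decide
    rw [hN k c h2, mul_zero]
  · rw [hM r k h1, zero_mul]

theorem glBracket_mem [Fintype n] (p : n → ZMod 2) {i j : ZMod 2} {M N : Matrix n n F}
    (hM : M ∈ glHomog F p i) (hN : N ∈ glHomog F p j) :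
    glBracket F p M N ∈ glHomog F p (i + j) := by
  rw [glBracket_eq p hM hN]
  refine sub_mem (glHomog_mul p hM hN) (Submodule.smul_mem _ _ ?_)
  rw [add_comm]
  exact glHomog_mul p hN hM

theorem glHomog_isCompl (p : n → ZMod 2) : IsCompl (glHomog F p 0) (glHomog F p 1) := by
  constructor
  · rw [Submodule.disjoint_def]
    intro M h0 h1
    rw [← glOdd_of_odd p h1, glOdd_of_even p h0]
  · rw [codisjoint_iff, eq_top_iff]
    intro M _
    refine Submodule.mem_sup.2 ⟨M - glOdd F p M, ?_, glOdd F p M, ?_, sub_add_cancel _ _⟩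
    · intro r c h
      have : p r + p c = 1 := (zmodTwo_cases _).resolve_left h
      simp [glOdd, this]
    · intro r c h
      simp [glOdd, h]

/-- The general linear Lie superalgebra of matrices whose index `r` has parity `p r`. -/
def glSuper (F : Type*) [Field F] {n : Type*} [Fintype n] (p : n → ZMod 2) :
    LieSuperalgebra F (Matrix n n F) where
  homog := glHomog F p
  isCompl := glHomog_isCompl p
  bracket := glBracket F p
  bracket_mem i j x y hx hy := glBracket_mem p hx hy
  skew i j x y hx hy := by
    rw [glBracket_eq p hx hy, glBracket_eq p hy hx]
    rcases zmodTwo_cases i with rfl | rfl <;> rcases zmodTwo_cases j with rfl | rfl <;>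
      simp [superSign, add_comm]
  jacobi i j x y z hx hy := by
    have key : ∀ (k : ZMod 2) (w : Matrix n n F), w ∈ glHomog F p k →
        glBracket F p x (glBracket F p y w) = glBracket F p (glBracket F p x y) w
          + superSign F i j • glBracket F p y (glBracket F p x w) := by
      intro k w hw
      rw [glBracket_eq p hx (glBracket_mem p hy hw), glBracket_eq p (glBracket_mem p hx hy) hw,
        glBracket_eq p hy (glBracket_mem p hx hw), glBracket_eq p hx hy, glBracket_eq p hy hw,
        glBracket_eq p hx hw]
      have e : (1 : ZMod 2) + 1 = 0 := by decide
      rcases zmodTwo_cases i with rfl | rfl <;> rcases zmodTwo_cases j with rfl | rfl <;>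
        rcases zmodTwo_cases k with rfl | rfl <;> simp [superSign, e] <;> noncomm_ring
    obtain ⟨z0, h0, z1, h1, rfl⟩ := Submodule.mem_sup.1
      ((codisjoint_iff.1 (glHomog_isCompl (F := F) p).codisjoint).symm ▸ Submodule.mem_top :
        z ∈ glHomog F p 0 ⊔ glHomog F p 1)
    simp only [map_add, smul_add, key 0 z0 h0, key 1 z1 h1]
    abel

end GeneralLinear

/-! ### The orthosymplectic Lie superalgebra `B(0,1) = osp(1,2)` and its modules -/

section Orthosymplectic

/-- Parities of the basis of the space `F^{1|2}`: the first vector is even, the others are odd. -/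
def parity12 : Fin 3 → ZMod 2 := ![0, 1, 1]

/-- The general linear Lie superalgebra `gl(1,2)`. -/
abbrev gl12 (F : Type*) [Field F] : LieSuperalgebra F (Matrix (Fin 3) (Fin 3) F) :=
  glSuper F parity12

/-- The underlying space of the orthosymplectic Lie superalgebra `osp(1,2)`. -/
def osp12 (F : Type*) [Field F] : Submodule F (Matrix (Fin 3) (Fin 3) F) where
  carrier := {M | ∃ α β γ μ ν : F, M = !![0, μ, ν; -ν, α, β; μ, γ, -α]}
  zero_mem' := ⟨0, 0, 0, 0, 0, by ext i j; fin_cases i <;> fin_cases j <;> simp⟩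
  add_mem' := by
    rintro _ _ ⟨a, b, c, m, k, rfl⟩ ⟨a', b', c', m', k', rfl⟩
    refine ⟨a + a', b + b', c + c', m + m', k + k', ?_⟩
    ext i j; fin_cases i <;> fin_cases j <;> simp [add_comm]
  smul_mem' := by
    rintro t _ ⟨a, b, c, m, k, rfl⟩
    refine ⟨t * a, t * b, t * c, t * m, t * k, ?_⟩
    ext i j; fin_cases i <;> fin_cases j <;> simp

/-- The copy `s` of the natural three-dimensional module of `osp(1,2)` inside `gl(1,2)`. -/
def natS (F : Type*) [Field F] : Submodule F (Matrix (Fin 3) (Fin 3) F) where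
  carrier := {M | ∃ α μ ν : F, M = !![2 * α, μ, ν; ν, α, 0; -μ, 0, α]}
  zero_mem' := ⟨0, 0, 0, by ext i j; fin_cases i <;> fin_cases j <;> simp⟩
  add_mem' := by
    rintro _ _ ⟨a, m, k, rfl⟩ ⟨a', m', k', rfl⟩
    refine ⟨a + a', m + m', k + k', ?_⟩
    ext i j; fin_cases i <;> fin_cases j <;> simp [add_comm, mul_add]
  smul_mem' := by
    rintro t _ ⟨a, m, k, rfl⟩
    refine ⟨t * a, t * m, t * k, ?_⟩
    ext i j; fin_cases i <;> fin_cases j <;> simp [mul_left_comm]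

variable {F : Type*} [Field F]

theorem gl12_bracket_apply (M N : Matrix (Fin 3) (Fin 3) F) :
    (gl12 F).bracket M N
      = M * N - N * M + (2 : F) • (glOdd F parity12 N * glOdd F parity12 M) := rfl

theorem glOdd12 (M : Matrix (Fin 3) (Fin 3) F) :
    glOdd F parity12 M = !![0, M 0 1, M 0 2; M 1 0, 0, 0; M 2 0, 0, 0] := by
  have e : (1 : ZMod 2) + 1 ≠ 1 := by decide
  ext i j
  fin_cases i <;> fin_cases j <;> simp [glOdd, parity12]

theorem osp12_isSubalgebra (F : Type*) [Field F] : (gl12 F).IsSubalgebra (osp12 F) where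
  graded := by
    rintro _ ⟨a, b, c, m, k, rfl⟩
    have e : (1 : ZMod 2) + 1 ≠ 1 := by decide
    have e' : (1 : ZMod 2) + 1 = 0 := by decide
    refine Submodule.mem_sup.2 ⟨!![0, 0, 0; -0, a, b; 0, c, -a],
      ⟨⟨a, b, c, 0, 0, rfl⟩, ?_⟩, !![0, m, k; -k, 0, 0; m, 0, -0],
      ⟨⟨0, 0, 0, m, k, rfl⟩, ?_⟩, ?_⟩
    · intro i j h
      fin_cases i <;> fin_cases j <;> simp_all [parity12]
    · intro i j h
      fin_cases i <;> fin_cases j <;> simp_all [parity12]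
    · ext i j; fin_cases i <;> fin_cases j <;> simp
  bracket_mem := by
    rintro _ ⟨a, b, c, m, k, rfl⟩ _ ⟨a', b', c', m', k', rfl⟩
    refine ⟨b * c' - c * b' - m * k' - k * m', 2 * a * b' - 2 * b * a' - 2 * k * k',
      2 * c * a' - 2 * a * c' + 2 * m * m', m * a' + k * c' - m' * a - k' * c,
      m * b' - k * a' - m' * b + k' * a, ?_⟩
    rw [gl12_bracket_apply, glOdd12, glOdd12]
    ext i j
    fin_cases i <;> fin_cases j <;> simp <;> ring

/-- The orthosymplectic Lie superalgebra `B(0,1) = osp(1,2)`, as a subalgebra of `gl(1,2)`. -/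
def ospSuper (F : Type*) [Field F] : LieSuperalgebra F (osp12 F) :=
  (gl12 F).restrict (osp12 F) (osp12_isSubalgebra F)

theorem natS_bracket_mem (M : osp12 F) (N : natS F) :
    (gl12 F).bracket M.1 N.1 ∈ natS F := by
  obtain ⟨_, a, b, c, m, k, rfl⟩ := M
  obtain ⟨_, a', m', k', rfl⟩ := N
  refine ⟨m * k' - k * m', -(m * a') - (m' * a + k' * c), -(k * a') - (m' * b - k' * a), ?_⟩
  rw [gl12_bracket_apply, glOdd12, glOdd12]
  ext i j
  fin_cases i <;> fin_cases j <;> simp <;> ring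

/-- The matrix, in block form `diag(1, (0, -1; 1, 0))`, that defines the automorphism `Φ`. -/
def phiMatrix (F : Type*) [Field F] : Matrix (Fin 3) (Fin 3) F := !![1, 0, 0; 0, 0, -1; 0, 1, 0]

/-- Conjugation by `phiMatrix`, the automorphism `Φ` of `gl(1,2)`. -/
noncomputable def phiGl (F : Type*) [Field F] :
    Matrix (Fin 3) (Fin 3) F →ₗ[F] Matrix (Fin 3) (Fin 3) F where
  toFun M := phiMatrix F * M * (phiMatrix F)⁻¹
  map_add' M N := by rw [mul_add, add_mul]
  map_smul' t M := by simp

theorem phiMatrix_inv : (phiMatrix F)⁻¹ = !![1, 0, 0; 0, 0, 1; 0, -1, 0] := by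
  apply Matrix.inv_eq_right_inv
  ext i j
  fin_cases i <;> fin_cases j <;> simp [phiMatrix, Matrix.mul_apply, Fin.sum_univ_three]

theorem phiGl_apply (M : Matrix (Fin 3) (Fin 3) F) : phiGl F M =
    !![M 0 0, -M 0 2, M 0 1; -M 2 0, M 2 2, -M 2 1; M 1 0, -M 1 2, M 1 1] := by
  change phiMatrix F * M * (phiMatrix F)⁻¹ = _
  rw [phiMatrix_inv]
  ext i j
  rw [Matrix.mul_apply, Fin.sum_univ_three]
  simp only [Matrix.mul_apply, Fin.sum_univ_three, phiMatrix]
  fin_cases i <;> fin_cases j <;> simp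

theorem phiGl_mem_osp12 : ∀ M ∈ osp12 F, phiGl F M ∈ osp12 F := by
  rintro _ ⟨a, b, c, m, k, rfl⟩
  refine ⟨-a, -c, -b, -k, m, ?_⟩
  rw [phiGl_apply]
  ext i j
  fin_cases i <;> fin_cases j <;> simp

theorem phiGl_mem_natS : ∀ M ∈ natS F, phiGl F M ∈ natS F := by
  rintro _ ⟨a, m, k, rfl⟩
  refine ⟨a, -k, m, ?_⟩
  rw [phiGl_apply]
  ext i j
  fin_cases i <;> fin_cases j <;> simp

/-- The restriction of `Φ` to `osp(1,2)`. -/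
noncomputable def phiOsp (F : Type*) [Field F] : osp12 F →ₗ[F] osp12 F :=
  (phiGl F).restrict phiGl_mem_osp12

/-- The restriction of `Φ` to the natural module `s`. -/
noncomputable def phiNatS (F : Type*) [Field F] : natS F →ₗ[F] natS F :=
  (phiGl F).restrict phiGl_mem_natS

/-- The even element `H` of `osp(1,2)`. -/
def ospH (F : Type*) [Field F] : osp12 F :=
  ⟨!![0, 0, 0; 0, 1, 0; 0, 0, -1], 1, 0, 0, 0, 0, by simp⟩

/-- The odd element `X` of `osp(1,2)`. -/
def ospX (F : Type*) [Field F] : osp12 F :=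
  ⟨!![0, 0, -1; 1, 0, 0; 0, 0, 0], 0, 0, 0, 0, -1, by simp⟩

end Orthosymplectic

/-! ### Strictly `B(0,1)`-graded Lie superalgebras -/

section Graded

variable {F : Type u} [Field F] {g : Type v} [AddCommGroup g] [Module F g]

/-- An embedding of `B(0,1) = osp(1,2)` in `g`, that is, an isomorphism of `osp(1,2)` with a
subalgebra of `g`. The superalgebra `g` is then a module for `osp(1,2)`, with `m` acting on `g` as
`[ι m, -]`. -/
structure B01Embedding (L : LieSuperalgebra F g) where
  toLin : osp12 F →ₗ[F] g
  isHom : (ospSuper F).IsHom L toLin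
  injective : Function.Injective toLin

namespace B01Embedding

variable {L : LieSuperalgebra F g} (ι : B01Embedding L)

/-- Parity preserving module homomorphisms from the adjoint module to `g`. The image of a nonzero
one is a copy of the adjoint module, with the natural parity. -/
def IsAdjointHom (f : osp12 F →ₗ[F] g) : Prop :=
  (∀ i, ∀ m ∈ (ospSuper F).homog i, f m ∈ L.homog i) ∧
    ∀ m x : osp12 F, f ((ospSuper F).bracket m x) = L.bracket (ι.toLin m) (f x)

/-- Parity preserving module homomorphisms from the natural module `F^{1|2}` of column vectors to
`g`. The image of a nonzero one is a copy of the natural module, with the natural parity. -/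
def IsNaturalHom (f : (Fin 3 → F) →ₗ[F] g) : Prop :=
  (∀ r : Fin 3, f (Pi.single r 1) ∈ L.homog (parity12 r)) ∧
    ∀ (m : osp12 F) (x : Fin 3 → F), f (m.1.mulVec x) = L.bracket (ι.toLin m) (f x)

/-- The largest trivial submodule of `g`: the centralizer of the subalgebra `osp(1,2)`. -/
def centralizer : Submodule F g where
  carrier := {d | ∀ m : osp12 F, L.bracket (ι.toLin m) d = 0}
  zero_mem' := fun m => map_zero _
  add_mem' := fun {x y} hx hy m => by rw [map_add, hx m, hy m, add_zero]
  smul_mem' := fun t x hx m => by rw [map_smul, hx m, smul_zero]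

/-- `g` is strictly `B(0,1)`-graded by means of the given subalgebra `osp(1,2)`: as a module for
this subalgebra, `g` is a sum of copies of the adjoint module and of the natural module, all with
the natural parity, and of a trivial module. -/
def IsStrictGrading : Prop :=
  (⨆ (f : osp12 F →ₗ[F] g) (_ : ι.IsAdjointHom f), LinearMap.range f) ⊔
    (⨆ (f : (Fin 3 → F) →ₗ[F] g) (_ : ι.IsNaturalHom f), LinearMap.range f) ⊔
    ι.centralizer = ⊤

/-- A decomposition `g = (osp(1,2) ⊗ A) ⊕ (s ⊗ B) ⊕ D` of `g` as a module for `osp(1,2)`, with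
vector spaces `A` and `B` (i.e. with no odd part) and with `D` the centralizer of `osp(1,2)`. -/
structure Decomposition (A : Type a) (B : Type b) [AddCommGroup A] [Module F A]
    [AddCommGroup B] [Module F B] where
  equiv : ((osp12 F ⊗[F] A) × (natS F ⊗[F] B) × ι.centralizer) ≃ₗ[F] g
  adj_parity : ∀ i, ∀ m ∈ (ospSuper F).homog i, ∀ a : A,
    equiv (m ⊗ₜ[F] a, 0, 0) ∈ L.homog i
  adj_bracket : ∀ (m x : osp12 F) (a : A), L.bracket (ι.toLin m) (equiv (x ⊗ₜ[F] a, 0, 0)) =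
    equiv ((ospSuper F).bracket m x ⊗ₜ[F] a, 0, 0)
  nat_parity : ∀ i, ∀ s : natS F, s.1 ∈ (gl12 F).homog i → ∀ b : B,
    equiv (0, s ⊗ₜ[F] b, 0) ∈ L.homog i
  nat_bracket : ∀ (m : osp12 F) (s : natS F) (b : B),
    L.bracket (ι.toLin m) (equiv (0, s ⊗ₜ[F] b, 0)) =
      equiv (0, (⟨(gl12 F).bracket m.1 s.1, natS_bracket_mem m s⟩ : natS F) ⊗ₜ[F] b, 0)
  triv : ∀ d : ι.centralizer, equiv (0, 0, d) = d

/-- The extension of `Φ` to `g`: it acts on the factors `osp(1,2)` and `s` of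
`(osp(1,2) ⊗ A) ⊕ (s ⊗ B) ⊕ D`, and as the identity on `A`, `B` and `D`. -/
noncomputable def Decomposition.phi {ι : B01Embedding L} {A : Type a} {B : Type b}
    [AddCommGroup A] [Module F A] [AddCommGroup B] [Module F B] (T : ι.Decomposition A B) :
    g →ₗ[F] g :=
  T.equiv.toLinearMap ∘ₗ
    ((phiOsp F).rTensor A).prodMap (((phiNatS F).rTensor B).prodMap LinearMap.id) ∘ₗ
      T.equiv.symm.toLinearMap

/-- The component `g_i` of the `5`-grading of `g` given by the action of `H`. -/
def grade (i : ℤ) : Submodule F g := L.adGrade (ι.toLin (ospH F)) i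

end B01Embedding

end Graded

/-! ### Freudenthal-Kantor triple systems -/

section TripleSystem

variable {F : Type*} [Field F] {U : Type*} [AddCommGroup U] [Module F U]

/-- The operator `K(x, y) : z ↦ xzy - δ yzx` of a triple product `t x y z = xyz`. -/
def fkK (δ : F) (t : U →ₗ[F] U →ₗ[F] U →ₗ[F] U) (x y : U) : U →ₗ[F] U :=
  (t x).flip y - δ • (t y).flip x

/-- `(ε, δ)` Freudenthal-Kantor triple systems, for `ε` and `δ` either `1` or `-1`. The operator
`L(x, y)` is `t x y`. -/
structure IsFreudenthalKantor (ε δ : F) (t : U →ₗ[F] U →ₗ[F] U →ₗ[F] U) : Prop where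
  eps : ε = 1 ∨ ε = -1
  del : δ = 1 ∨ δ = -1
  fk1 : ∀ u v x y : U, t u v ∘ₗ t x y - t x y ∘ₗ t u v = t (t u v x) y + ε • t x (t v u y)
  fk2 : ∀ u v x y : U, fkK δ t (fkK δ t u v x) y =
    t y x ∘ₗ fkK δ t u v - ε • (fkK δ t u v ∘ₗ t x y)

/-- `e` is a left unit of a triple system: `L(e, e) = id`. -/
def IsLeftUnit (t : U →ₗ[F] U →ₗ[F] U →ₗ[F] U) (e : U) : Prop := ∀ x, t e e x = x

end TripleSystem

/-! ### Bracket rules for even and odd elements -/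

namespace LieSuperalgebra

variable {F : Type*} [Field F] {g : Type*} [AddCommGroup g] [Module F g]
  (L : LieSuperalgebra F g)

/-! Everything rests on the even part sl(2) of osp(1,2), spanned by E, H, F. On adjoint, natural and
trivial summands ad E and ad F have zero cube and ad H has eigenvalues among -2, ..., 2. As 2 and 3
are invertible, the exponentials of -ad E and ad F are automorphisms of g
(`LieSuperalgebra.expCube_bracket`). On gl(1,2) the Weyl group element exp(-ad E) exp(ad F) exp(-ad
E) is conjugation by `phiMatrix` (`coe_ospWeyl`), so in every decomposition Φ is the action of this
element on g (`phi_eq_weyl`). Hence Φ is an automorphism that does not depend on the decomposition.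

For the grading, the delicate point is that [g_i, g_j] = 0 when |i + j| > 2: in characteristic 5 the
eigenvalues 3 and 4 coincide with -2 and -1. If i + j > 2, both factors are killed by ad E, so their
bracket is a highest weight vector; since (ad F)^3 = 0, its weight cannot be 3 or 4
(`sl2_highest_weight`).

On U = g_1, which is odd, Φ² = -1, and [[U, U], U] lies in g_3 = 0. These facts suffice for the
Freudenthal–Kantor identities (`isFreudenthalKantor_tripleProduct`): L(x, y) is the derivation given
by the even element [x, Φ(y)], and K(u, v) is z ↦ -[[u, v], Φ(z)]. The element X is a left unit
because [X, Φ(X)] = H, and XxX = x because (ad X)² Φ = -1 on g_1.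

A decomposition is obtained by taking for A and B the spaces of parity preserving homomorphisms from
osp(1,2) and s to g. Evaluation is onto by the definition of a strict grading and injective by a
comparison of weights (`evaluationSum_injective`). In an arbitrary decomposition the element 1 is
found by applying (ad E)² to F (`exists_toLin_eq`). -/

theorem exists_add_homog (x : g) : ∃ y ∈ L.homog 0, ∃ z ∈ L.homog 1, y + z = x :=
  Submodule.mem_sup.1 ((codisjoint_iff.1 L.isCompl.codisjoint).symm ▸ Submodule.mem_top)

theorem eq_zero_of_mem {x : g} (h0 : x ∈ L.homog 0) (h1 : x ∈ L.homog 1) : x = 0 :=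
  Submodule.disjoint_def.1 L.isCompl.disjoint x h0 h1

/-- Even elements act as derivations. -/
theorem bracket_even {x : g} (hx : x ∈ L.homog 0) (y z : g) :
    L.bracket x (L.bracket y z) = L.bracket (L.bracket x y) z + L.bracket y (L.bracket x z) := by
  obtain ⟨y0, h0, y1, h1, rfl⟩ := L.exists_add_homog y
  have e0 := L.jacobi 0 0 x y0 z hx h0
  have e1 := L.jacobi 0 1 x y1 z hx h1
  simp only [superSign, zero_ne_one, false_and, if_false, one_smul] at e0 e1
  simp only [map_add, LinearMap.add_apply, e0, e1]
  abel

theorem skew_even {x : g} (hx : x ∈ L.homog 0) (y : g) : L.bracket x y = -L.bracket y x := by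
  obtain ⟨y0, h0, y1, h1, rfl⟩ := L.exists_add_homog y
  have e0 := L.skew 0 0 x y0 hx h0
  have e1 := L.skew 0 1 x y1 hx h1
  simp only [superSign, zero_ne_one, false_and, if_false, one_smul] at e0 e1
  simp only [map_add, LinearMap.add_apply, e0, e1]
  abel

theorem symm_odd {x y : g} (hx : x ∈ L.homog 1) (hy : y ∈ L.homog 1) :
    L.bracket x y = L.bracket y x := by
  simpa [superSign] using L.skew 1 1 x y hx hy

theorem bracket_odd {x y : g} (hx : x ∈ L.homog 1) (hy : y ∈ L.homog 1) (z : g) :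
    L.bracket x (L.bracket y z) = L.bracket (L.bracket x y) z - L.bracket y (L.bracket x z) := by
  simpa [superSign, sub_eq_add_neg] using L.jacobi 1 1 x y z hx hy

theorem bracket_odd_odd {x y : g} (hx : x ∈ L.homog 1) (hy : y ∈ L.homog 1) :
    L.bracket x y ∈ L.homog 0 := by
  have := L.bracket_mem 1 1 x y hx hy
  rwa [show (1 : ZMod 2) + 1 = 0 by decide] at this

theorem bracket_even_mem {x y : g} {i : ZMod 2} (hx : x ∈ L.homog 0) (hy : y ∈ L.homog i) :
    L.bracket x y ∈ L.homog i := by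
  simpa using L.bracket_mem 0 i x y hx hy

end LieSuperalgebra

/-! ### Truncated exponentials -/

section Exponential

variable {F : Type*} [Field F] {M N : Type*} [AddCommGroup M] [Module F M]
  [AddCommGroup N] [Module F N]

/-- The exponential of an operator whose cube is zero. -/
def expCube (D : Module.End F M) : Module.End F M := 1 + D + (2⁻¹ : F) • (D * D)

theorem expCube_apply (D : Module.End F M) (x : M) :
    expCube D x = x + D x + (2⁻¹ : F) • D (D x) := rfl

theorem expCube_intertwine {D : Module.End F M} {D' : Module.End F N} {f : M →ₗ[F] N}
    (h : ∀ x, D' (f x) = f (D x)) (x : M) : expCube D' (f x) = f (expCube D x) := by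
  simp [expCube_apply, h]

theorem expCube_bijective (h2 : (2 : F) ≠ 0)
    {D : Module.End F M} (hD : ∀ x, D (D (D x)) = 0) : Function.Bijective (expCube D) := by
  have key : ∀ D : Module.End F M, (∀ x, D (D (D x)) = 0) →
      ∀ x, expCube (-D) (expCube D x) = x := fun D hD x => by
    have hh : (2 : F)⁻¹ * 2 = 1 := inv_mul_cancel₀ h2
    simp only [expCube_apply, map_add, map_smul, LinearMap.neg_apply, map_neg, hD, map_zero]
    match_scalars <;> first | ring1 | linear_combination hh
  have hD' : ∀ x, (-D) ((-D) ((-D) x)) = 0 := fun x => by simp [hD]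
  refine Function.bijective_iff_has_inverse.2 ⟨expCube (-D), key D hD, fun x => ?_⟩
  simpa using key (-D) hD' x

/-- By the Leibniz rule the two sides differ only in terms of degree 3 and 4 in `D`. The expansions
of `D³[x, y] = 0` and `D⁴[x, y] = 0` are 3 and 6 times the sums that occur there, so these terms
vanish. -/
theorem LieSuperalgebra.expCube_bracket (h2 : (2 : F) ≠ 0) (h3 : (3 : F) ≠ 0)
    (L : LieSuperalgebra F M) (D : Module.End F M)
    (hD : ∀ x y, D (L.bracket x y) = L.bracket (D x) y + L.bracket x (D y))
    (hc : ∀ x, D (D (D x)) = 0) (x y : M) :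
    expCube D (L.bracket x y) = L.bracket (expCube D x) (expCube D y) := by
  have e3 : (3 : F) • (L.bracket (D x) (D (D y)) + L.bracket (D (D x)) (D y)) = 0 := by
    have := hc (L.bracket x y)
    simp only [hD, map_add, hc, map_zero, LinearMap.zero_apply] at this
    rw [← this]
    module
  have e3' := (smul_eq_zero.1 e3).resolve_left h3
  have e4 : (6 : F) • L.bracket (D (D x)) (D (D y)) = 0 := by
    have := congrArg D (hc (L.bracket x y))
    simp only [hD, map_add, hc, map_zero, LinearMap.zero_apply] at this
    rw [← this]
    module
  have h6 : (6 : F) ≠ 0 := by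
    rw [show (6 : F) = 2 * 3 by norm_num]; exact mul_ne_zero h2 h3
  have e4' := (smul_eq_zero.1 e4).resolve_left h6
  have e3'' : L.bracket (D (D x)) (D y) = -L.bracket (D x) (D (D y)) :=
    eq_neg_of_add_eq_zero_right e3'
  have hh : (2 : F)⁻¹ * 2 = 1 := inv_mul_cancel₀ h2
  simp only [expCube_apply, hD, map_add, map_smul, LinearMap.add_apply, LinearMap.smul_apply, e4',
    e3'']
  match_scalars <;> first | ring1 | linear_combination hh

end Exponential

/-! ### Computations in `gl(1,2)` -/

section Matrices

variable {F : Type*} [Field F]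

/-- The even positive root vector of `osp(1,2)`. -/
def ospE (F : Type*) [Field F] : osp12 F :=
  ⟨!![0, 0, 0; 0, 0, 1; 0, 0, 0], 0, 1, 0, 0, 0, by simp⟩

/-- The even negative root vector of `osp(1,2)`. -/
def ospF (F : Type*) [Field F] : osp12 F :=
  ⟨!![0, 0, 0; 0, 0, 0; 0, 1, 0], 0, 0, 1, 0, 0, by simp⟩

/-- The odd negative root vector of `osp(1,2)`. -/
def ospY (F : Type*) [Field F] : osp12 F :=
  ⟨!![0, 1, 0; 0, 0, 0; 1, 0, 0], 0, 0, 0, 1, 0, by simp⟩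

theorem gl_bracket_ospE (M : Matrix (Fin 3) (Fin 3) F) : (gl12 F).bracket (ospE F).1 M =
    !![0, 0, -M 0 1; M 2 0, M 2 1, M 2 2 - M 1 1; 0, 0, -M 2 1] := by
  rw [gl12_bracket_apply, glOdd12, glOdd12, ospE]
  ext i j
  fin_cases i <;> fin_cases j <;>
    simp [Matrix.mul_apply, Matrix.vecMul, dotProduct, Fin.sum_univ_three]

theorem gl_bracket_ospF (M : Matrix (Fin 3) (Fin 3) F) : (gl12 F).bracket (ospF F).1 M =
    !![0, -M 0 2, 0; 0, -M 1 2, 0; M 1 0, M 1 1 - M 2 2, M 1 2] := by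
  rw [gl12_bracket_apply, glOdd12, glOdd12, ospF]
  ext i j
  fin_cases i <;> fin_cases j <;>
    simp [Matrix.mul_apply, Matrix.vecMul, dotProduct, Fin.sum_univ_three]

theorem gl_bracket_ospH (M : Matrix (Fin 3) (Fin 3) F) : (gl12 F).bracket (ospH F).1 M =
    !![0, -M 0 1, M 0 2; M 1 0, 0, 2 * M 1 2; -M 2 0, -2 * M 2 1, 0] := by
  rw [gl12_bracket_apply, glOdd12, glOdd12, ospH]
  ext i j
  fin_cases i <;> fin_cases j <;>
    simp [Matrix.mul_apply, Matrix.vecMul, dotProduct, Fin.sum_univ_three] <;> ring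

theorem gl_bracket_ospX (M : Matrix (Fin 3) (Fin 3) F) : (gl12 F).bracket (ospX F).1 M =
    !![M 0 1 - M 2 0, -M 2 1, M 0 0 - M 2 2;
      M 0 0 - M 1 1, M 0 1, M 0 2 - M 1 0; -M 2 1, 0, -M 2 0] := by
  rw [gl12_bracket_apply, glOdd12, glOdd12, ospX]
  ext i j
  fin_cases i <;> fin_cases j <;>
    simp [Matrix.mul_apply, Matrix.vecMul, dotProduct, Fin.sum_univ_three] <;> ring_nf

theorem gl_bracket_ospY (M : Matrix (Fin 3) (Fin 3) F) : (gl12 F).bracket (ospY F).1 M =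
    !![M 1 0 + M 0 2, M 1 1 - M 0 0, M 1 2; -M 1 2, M 1 0, 0;
      M 0 0 - M 2 2, M 0 1 + M 2 0, M 0 2] := by
  rw [gl12_bracket_apply, glOdd12, glOdd12, ospY]
  ext i j
  fin_cases i <;> fin_cases j <;>
    simp [Matrix.mul_apply, Matrix.vecMul, dotProduct, Fin.sum_univ_three] <;> ring_nf

end Matrices

/-! ### Intertwiners from subspaces of `gl(1,2)` -/

section Intertwiners

variable {F : Type*} [Field F]

/-- Subspaces of `gl(1,2)` stable under the action of `osp(1,2)`. -/
structure IsOspStable (S : Submodule F (Matrix (Fin 3) (Fin 3) F)) : Prop where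
  graded : S ≤ (S ⊓ (gl12 F).homog 0) ⊔ (S ⊓ (gl12 F).homog 1)
  bracket_mem : ∀ (m : osp12 F), ∀ s ∈ S, (gl12 F).bracket m.1 s ∈ S

theorem osp12_stable : IsOspStable (osp12 F) where
  graded := (osp12_isSubalgebra F).graded
  bracket_mem m s hs := (osp12_isSubalgebra F).bracket_mem m.1 m.2 s hs

theorem natS_stable : IsOspStable (natS F) where
  graded := by
    rintro _ ⟨a, m, k, rfl⟩
    have e : (1 : ZMod 2) + 1 ≠ 1 := by decide
    have e' : (1 : ZMod 2) + 1 = 0 := by decide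
    refine Submodule.mem_sup.2 ⟨!![2 * a, 0, 0; 0, a, 0; -0, 0, a], ⟨⟨a, 0, 0, rfl⟩, ?_⟩,
      !![2 * 0, m, k; k, 0, 0; -m, 0, 0], ⟨⟨0, m, k, rfl⟩, ?_⟩, ?_⟩
    · intro i j h
      fin_cases i <;> fin_cases j <;> simp_all [parity12]
    · intro i j h
      fin_cases i <;> fin_cases j <;> simp_all [parity12]
    · ext i j; fin_cases i <;> fin_cases j <;> simp
  bracket_mem m s hs := natS_bracket_mem m ⟨s, hs⟩

/-- The action of `osp(1,2)` on a stable subspace of `gl(1,2)`. -/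
def ospAct {S : Submodule F (Matrix (Fin 3) (Fin 3) F)} (hS : IsOspStable S) (m : osp12 F) :
    Module.End F S := ((gl12 F).bracket m.1).restrict (hS.bracket_mem m)

variable {S : Submodule F (Matrix (Fin 3) (Fin 3) F)} (hS : IsOspStable S)

theorem coe_ospAct (m : osp12 F) (s : S) : (ospAct hS m s : Matrix _ _ F) =
    (gl12 F).bracket m.1 s.1 := rfl

/-- The action of the Weyl group element on a stable subspace of `gl(1,2)`. -/
def ospWeyl (s : S) : S :=
  expCube (-ospAct hS (ospE F)) (expCube (ospAct hS (ospF F)) (expCube (-ospAct hS (ospE F)) s))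

theorem coe_expCube_neg_ospE (h2 : (2 : F) ≠ 0) (s : S) :
    (expCube (-ospAct hS (ospE F)) s : Matrix _ _ F) =
      !![s.1 0 0, s.1 0 1, s.1 0 2 + s.1 0 1;
        s.1 1 0 - s.1 2 0, s.1 1 1 - s.1 2 1, s.1 1 2 - s.1 2 2 + s.1 1 1 - s.1 2 1;
        s.1 2 0, s.1 2 1, s.1 2 2 + s.1 2 1] := by
  have e : (2 : F)⁻¹ * 2 = 1 := inv_mul_cancel₀ h2
  simp only [expCube_apply, LinearMap.neg_apply, map_neg, neg_neg, Submodule.coe_add,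
    Submodule.coe_neg, Submodule.coe_smul, coe_ospAct, gl_bracket_ospE]
  ext i j
  fin_cases i <;> fin_cases j <;> simp <;> first | ring1 | linear_combination -s.1 2 1 * e

theorem coe_expCube_ospF (h2 : (2 : F) ≠ 0) (s : S) :
    (expCube (ospAct hS (ospF F)) s : Matrix _ _ F) =
      !![s.1 0 0, s.1 0 1 - s.1 0 2, s.1 0 2; s.1 1 0, s.1 1 1 - s.1 1 2, s.1 1 2;
        s.1 2 0 + s.1 1 0, s.1 2 1 + s.1 1 1 - s.1 2 2 - s.1 1 2, s.1 2 2 + s.1 1 2] := by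
  have e : (2 : F)⁻¹ * 2 = 1 := inv_mul_cancel₀ h2
  simp only [expCube_apply, Submodule.coe_add, Submodule.coe_smul, coe_ospAct, gl_bracket_ospF]
  ext i j
  fin_cases i <;> fin_cases j <;> simp <;> first | ring1 | linear_combination -s.1 1 2 * e

/-- The matrices E and F have square zero, so exp(t ad E) is conjugation by 1 + tE, and likewise for
F. The product (1 - E)(1 + F)(1 - E) is `phiMatrix`. -/
theorem coe_ospWeyl (h2 : (2 : F) ≠ 0) (s : S) : (ospWeyl hS s : Matrix _ _ F) = phiGl F s.1 := by
  rw [ospWeyl, coe_expCube_neg_ospE hS h2, coe_expCube_ospF hS h2, coe_expCube_neg_ospE hS h2,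
    phiGl_apply]
  ext i j
  fin_cases i <;> fin_cases j <;> simp <;> ring

theorem ospH_mem : (ospH F).1 ∈ (gl12 F).homog 0 := by
  intro i j h
  have e' : (1 : ZMod 2) + 1 = 0 := by decide
  fin_cases i <;> fin_cases j <;> simp_all [parity12, ospH]

theorem ospE_mem : (ospE F).1 ∈ (gl12 F).homog 0 := by
  intro i j h
  have e' : (1 : ZMod 2) + 1 = 0 := by decide
  fin_cases i <;> fin_cases j <;> simp_all [parity12, ospE]

theorem ospF_mem : (ospF F).1 ∈ (gl12 F).homog 0 := by
  intro i j h
  have e' : (1 : ZMod 2) + 1 = 0 := by decide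
  fin_cases i <;> fin_cases j <;> simp_all [parity12, ospF]

end Intertwiners

/-! ### Homomorphisms from submodules of `gl(1,2)` to `g` -/

namespace B01Embedding

variable {F : Type u} [Field F] {g : Type v} [AddCommGroup g] [Module F g]
  {L : LieSuperalgebra F g} (ι : B01Embedding L)

/-- Parity preserving homomorphisms of `osp(1,2)`-modules from a subspace of `gl(1,2)`. -/
def IsIntertwiner {S : Submodule F (Matrix (Fin 3) (Fin 3) F)} (f : S →ₗ[F] g) : Prop :=
  (∀ i, ∀ s : S, s.1 ∈ (gl12 F).homog i → f s ∈ L.homog i) ∧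
    ∀ (m : osp12 F) (s t : S), t.1 = (gl12 F).bracket m.1 s.1 → f t = L.bracket (ι.toLin m) (f s)

variable {ι}

theorem IsIntertwiner.bracket {S : Submodule F (Matrix (Fin 3) (Fin 3) F)} {f : S →ₗ[F] g}
    (hf : ι.IsIntertwiner f) (hS : IsOspStable S) (m : osp12 F) (s : S) :
    L.bracket (ι.toLin m) (f s) = f (ospAct hS m s) :=
  (hf.2 m s _ rfl).symm

theorem isIntertwiner_iff_isAdjointHom (f : osp12 F →ₗ[F] g) :
    ι.IsIntertwiner f ↔ ι.IsAdjointHom f := by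
  refine and_congr Iff.rfl ⟨fun h m x => h m x _ rfl, fun h m s t e => ?_⟩
  rw [← h m s]
  exact congrArg f (Subtype.ext e)

theorem isIntertwiner_toLin : ι.IsIntertwiner ι.toLin :=
  (isIntertwiner_iff_isAdjointHom _).2 ⟨ι.isHom.map_homog, ι.isHom.map_bracket⟩

/-- The isomorphism from `natS` to the natural module of column vectors. -/
def natSToColumn (F : Type*) [Field F] : natS F →ₗ[F] (Fin 3 → F) where
  toFun s := ![s.1 1 1, s.1 1 0, -s.1 0 1]
  map_add' s t := by ext i; fin_cases i <;> simp [add_comm]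
  map_smul' c s := by ext i; fin_cases i <;> simp

theorem natSToColumn_surjective : Function.Surjective (natSToColumn F) := by
  intro v
  refine ⟨⟨!![2 * v 0, -v 2, v 1; v 1, v 0, 0; -(-v 2), 0, v 0], _, _, _, rfl⟩, ?_⟩
  ext i; fin_cases i <;> simp [natSToColumn]

theorem natSToColumn_bracket (m : osp12 F) (s t : natS F) (h : t.1 = (gl12 F).bracket m.1 s.1) :
    natSToColumn F t = m.1.mulVec (natSToColumn F s) := by
  obtain ⟨_, a, b, c, p, q, rfl⟩ := m
  obtain ⟨_, a', p', q', rfl⟩ := s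
  change ![t.1 1 1, t.1 1 0, -t.1 0 1] = _
  rw [h, gl12_bracket_apply, glOdd12, glOdd12]
  ext i
  fin_cases i <;> simp [natSToColumn, Matrix.mulVec, dotProduct, Fin.sum_univ_three] <;> ring

theorem IsNaturalHom.isIntertwiner {f : (Fin 3 → F) →ₗ[F] g} (hf : ι.IsNaturalHom f) :
    ι.IsIntertwiner (f ∘ₗ natSToColumn F) := by
  refine ⟨fun i s hs => ?_, fun m s t h => ?_⟩
  · have e : natSToColumn F s = s.1 1 1 • Pi.single 0 1 + s.1 1 0 • Pi.single 1 1
        + -s.1 0 1 • Pi.single 2 1 := by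
      ext i; fin_cases i <;> simp [natSToColumn]
    rw [LinearMap.comp_apply, e]
    simp only [map_add, map_smul]
    have h1 : f (Pi.single 0 1) ∈ L.homog 0 := hf.1 0
    have h2 := hf.1 1
    have h3 := hf.1 2
    rcases zmodTwo_cases i with rfl | rfl
    · rw [hs 1 0 (by decide), hs 0 1 (by decide)]
      simpa using Submodule.smul_mem _ (s.1 1 1) h1
    · rw [hs 1 1 (by decide), zero_smul, zero_add]
      exact add_mem (Submodule.smul_mem _ _ h2) (Submodule.smul_mem _ _ h3)
  · simp only [LinearMap.comp_apply]
    rw [natSToColumn_bracket m s t h, hf.2]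

theorem IsStrictGrading.induction_summands (hg : ι.IsStrictGrading) {p : g → Prop}
    (hadd : ∀ x y, p x → p y → p (x + y))
    (hf : ∀ f : osp12 F →ₗ[F] g, ι.IsIntertwiner f → ∀ s, p (f s))
    (hf' : ∀ f : natS F →ₗ[F] g, ι.IsIntertwiner f → ∀ s, p (f s))
    (hd : ∀ d ∈ ι.centralizer, p d) (z : g) : p z := by
  have p0 : p 0 := hd 0 (zero_mem _)
  have hz : z ∈ (⊤ : Submodule F g) := Submodule.mem_top
  rw [← hg] at hz
  obtain ⟨w, hw, d, hd', rfl⟩ := Submodule.mem_sup.1 hz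
  obtain ⟨x, hx, y, hy, rfl⟩ := Submodule.mem_sup.1 hw
  refine hadd _ _ (hadd _ _ ?_ ?_) (hd d hd')
  · refine Submodule.iSup_induction _ (motive := p) hx (fun f x hx => ?_) p0 hadd
    refine Submodule.iSup_induction _ (motive := p) hx (fun h x hx => ?_) p0 hadd
    obtain ⟨s, rfl⟩ := hx
    exact hf f ((isIntertwiner_iff_isAdjointHom f).2 h) s
  · refine Submodule.iSup_induction _ (motive := p) hy (fun f y hy => ?_) p0 hadd
    refine Submodule.iSup_induction _ (motive := p) hy (fun h y hy => ?_) p0 hadd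
    obtain ⟨w, rfl⟩ := hy
    obtain ⟨s, rfl⟩ := natSToColumn_surjective w
    exact hf' _ h.isIntertwiner s

/-- Adjoint and natural summands are treated at once: the operator identities below already hold for
all matrices in gl(1,2), hence on every stable subspace. -/
theorem IsStrictGrading.induction (hg : ι.IsStrictGrading) {p : g → Prop}
    (hadd : ∀ x y, p x → p y → p (x + y))
    (hf : ∀ (S : Submodule F (Matrix (Fin 3) (Fin 3) F)), IsOspStable S →
      ∀ f : S →ₗ[F] g, ι.IsIntertwiner f → ∀ s, p (f s))
    (hd : ∀ d ∈ ι.centralizer, p d) (z : g) : p z :=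
  hg.induction_summands hadd (hf _ osp12_stable) (hf _ natS_stable) hd z

/-! ### Operator identities in strictly graded superalgebras -/

variable (ι) in
/-- The Weyl group element `exp(-ad E) exp(ad F) exp(-ad E)` acting on `g`. -/
def weyl : Module.End F g :=
  expCube (-L.bracket (ι.toLin (ospE F))) * expCube (L.bracket (ι.toLin (ospF F))) *
    expCube (-L.bracket (ι.toLin (ospE F)))

theorem IsIntertwiner.weyl {S : Submodule F (Matrix (Fin 3) (Fin 3) F)} {f : S →ₗ[F] g}
    (hf : ι.IsIntertwiner f) (hS : IsOspStable S) (s : S) :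
    ι.weyl (f s) = f (ospWeyl hS s) := by
  have hE : ∀ s, (-L.bracket (ι.toLin (ospE F))) (f s) = f ((-ospAct hS (ospE F)) s) :=
    fun s => by simp [hf.bracket hS]
  simp only [B01Embedding.weyl, Module.End.mul_apply, expCube_intertwine hE,
    expCube_intertwine (hf.bracket hS (ospF F)), ospWeyl]

theorem weyl_of_mem_centralizer {d : g} (hd : d ∈ ι.centralizer) : ι.weyl d = d := by
  have hd' : ∀ m : osp12 F, L.bracket (ι.toLin m) d = 0 := hd
  simp [weyl, expCube_apply, hd']

namespace IsStrictGrading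

variable (hg : ι.IsStrictGrading)
include hg

theorem bracket_ospE_cube (z : g) :
    L.bracket (ι.toLin (ospE F)) (L.bracket (ι.toLin (ospE F))
      (L.bracket (ι.toLin (ospE F)) z)) = 0 := by
  induction z using hg.induction with
  | hadd x y hx hy =>
    simp only [map_add] at hx hy ⊢
    linear_combination (norm := module) hx + hy
  | hf S hS f hf s =>
    simp only [hf.bracket hS]
    refine (congrArg f (Subtype.ext ?_)).trans (map_zero f)
    simp only [coe_ospAct, gl_bracket_ospE]
    ext i j
    fin_cases i <;> fin_cases j <;> simp
  | hd d hd =>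
    have hd' : ∀ m : osp12 F, L.bracket (ι.toLin m) d = 0 := hd
    simp [hd']

theorem bracket_ospF_cube (z : g) :
    L.bracket (ι.toLin (ospF F)) (L.bracket (ι.toLin (ospF F))
      (L.bracket (ι.toLin (ospF F)) z)) = 0 := by
  induction z using hg.induction with
  | hadd x y hx hy =>
    simp only [map_add] at hx hy ⊢
    linear_combination (norm := module) hx + hy
  | hf S hS f hf s =>
    simp only [hf.bracket hS]
    refine (congrArg f (Subtype.ext ?_)).trans (map_zero f)
    simp only [coe_ospAct, gl_bracket_ospF]
    ext i j
    fin_cases i <;> fin_cases j <;> simp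
  | hd d hd =>
    have hd' : ∀ m : osp12 F, L.bracket (ι.toLin m) d = 0 := hd
    simp [hd']

/-- The polynomial is H(H + 1)(H + 2), which kills the weights 0, -1, -2 and takes the values 6 and
24 on the weights 1 and 2, which ad E kills. Stating facts about weight vectors through polynomials
in ad H makes them linear in `z`, so that they can be checked on summands. -/
theorem bracket_ospE_weights (z : g) :
    L.bracket (ι.toLin (ospE F)) (L.bracket (ι.toLin (ospH F))
      (L.bracket (ι.toLin (ospH F)) (L.bracket (ι.toLin (ospH F)) z)) +
    (3 : F) • L.bracket (ι.toLin (ospH F)) (L.bracket (ι.toLin (ospH F)) z) +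
    (2 : F) • L.bracket (ι.toLin (ospH F)) z) = 0 := by
  induction z using hg.induction with
  | hadd x y hx hy =>
    simp only [map_add, map_smul] at hx hy ⊢
    linear_combination (norm := module) hx + hy
  | hf S hS f hf s =>
    simp only [hf.bracket hS, ← map_add, ← map_smul]
    refine (congrArg f (Subtype.ext ?_)).trans (map_zero f)
    simp only [coe_ospAct, Submodule.coe_add, Submodule.coe_smul, gl_bracket_ospE, gl_bracket_ospH]
    ext i j
    fin_cases i <;> fin_cases j <;> simp [-mul_eq_zero, -mul_eq_mul_left_iff] <;> ring
  | hd d hd =>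
    have hd' : ∀ m : osp12 F, L.bracket (ι.toLin m) d = 0 := hd
    simp [hd']

/-- The polynomial is H(H - 1)(H - 2), which leaves only the negative weights. -/
theorem bracket_ospF_weights (z : g) :
    L.bracket (ι.toLin (ospF F)) (L.bracket (ι.toLin (ospH F))
      (L.bracket (ι.toLin (ospH F)) (L.bracket (ι.toLin (ospH F)) z)) -
    (3 : F) • L.bracket (ι.toLin (ospH F)) (L.bracket (ι.toLin (ospH F)) z) +
    (2 : F) • L.bracket (ι.toLin (ospH F)) z) = 0 := by
  induction z using hg.induction with
  | hadd x y hx hy =>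
    simp only [map_add, map_sub, map_smul] at hx hy ⊢
    linear_combination (norm := module) hx + hy
  | hf S hS f hf s =>
    simp only [hf.bracket hS, ← map_add, ← map_sub, ← map_smul]
    refine (congrArg f (Subtype.ext ?_)).trans (map_zero f)
    simp only [coe_ospAct, Submodule.coe_add, Submodule.coe_sub, Submodule.coe_smul,
      gl_bracket_ospF, gl_bracket_ospH]
    ext i j
    fin_cases i <;> fin_cases j <;> simp [-mul_eq_zero, -mul_eq_mul_left_iff] <;> ring
  | hd d hd =>
    have hd' : ∀ m : osp12 F, L.bracket (ι.toLin m) d = 0 := hd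
    simp [hd']

/-- This is H(H² - 1)(H² - 4) = 0. -/
theorem bracket_ospH_weights (z : g) :
    L.bracket (ι.toLin (ospH F)) (L.bracket (ι.toLin (ospH F))
      (L.bracket (ι.toLin (ospH F)) (L.bracket (ι.toLin (ospH F))
        (L.bracket (ι.toLin (ospH F)) z)))) -
    (5 : F) • L.bracket (ι.toLin (ospH F)) (L.bracket (ι.toLin (ospH F))
      (L.bracket (ι.toLin (ospH F)) z)) +
    (4 : F) • L.bracket (ι.toLin (ospH F)) z = 0 := by
  induction z using hg.induction with
  | hadd x y hx hy =>
    simp only [map_add] at hx hy ⊢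
    linear_combination (norm := module) hx + hy
  | hf S hS f hf s =>
    simp only [hf.bracket hS, ← map_add, ← map_sub, ← map_smul]
    refine (congrArg f (Subtype.ext ?_)).trans (map_zero f)
    simp only [coe_ospAct, Submodule.coe_add, Submodule.coe_sub, Submodule.coe_smul,
      gl_bracket_ospH]
    ext i j
    fin_cases i <;> fin_cases j <;> simp [-mul_eq_zero, -mul_eq_mul_left_iff] <;> ring
  | hd d hd =>
    have hd' : ∀ m : osp12 F, L.bracket (ι.toLin m) d = 0 := hd
    simp [hd']

/-- The polynomial H(H² - 4) leaves only the weights 1 and -1, where the square of the Weyl element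
is -1. -/
theorem weyl_weyl (h2 : (2 : F) ≠ 0) (z : g) :
    ι.weyl (ι.weyl (L.bracket (ι.toLin (ospH F)) (L.bracket (ι.toLin (ospH F))
      (L.bracket (ι.toLin (ospH F)) z)) -
    (4 : F) • L.bracket (ι.toLin (ospH F)) z)) +
    (L.bracket (ι.toLin (ospH F)) (L.bracket (ι.toLin (ospH F)) (L.bracket (ι.toLin (ospH F)) z)) -
    (4 : F) • L.bracket (ι.toLin (ospH F)) z) = 0 := by
  induction z using hg.induction with
  | hadd x y hx hy =>
    simp only [map_add, map_sub, map_smul] at hx hy ⊢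
    linear_combination (norm := module) hx + hy
  | hf S hS f hf s =>
    simp only [hf.bracket hS, hf.weyl hS, ← map_add, ← map_sub, ← map_smul]
    refine (congrArg f (Subtype.ext ?_)).trans (map_zero f)
    simp only [coe_ospAct, Submodule.coe_add, Submodule.coe_sub, Submodule.coe_smul,
      coe_ospWeyl hS h2, phiGl_apply, gl_bracket_ospH]
    ext i j
    fin_cases i <;> fin_cases j <;> simp [-mul_eq_zero, -mul_eq_mul_left_iff] <;> ring
  | hd d hd =>
    have hd' : ∀ m : osp12 F, L.bracket (ι.toLin m) d = 0 := hd
    simp [hd']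

/-- The polynomial H(H + 1)(H² - 4) leaves only the weight 1, where its value is -6. -/
theorem bracket_ospX_ospX_weyl (h2 : (2 : F) ≠ 0) (z : g) :
    L.bracket (ι.toLin (ospX F)) (L.bracket (ι.toLin (ospX F)) (ι.weyl
      (L.bracket (ι.toLin (ospH F)) (L.bracket (ι.toLin (ospH F))
        (L.bracket (ι.toLin (ospH F)) (L.bracket (ι.toLin (ospH F)) z))) +
    L.bracket (ι.toLin (ospH F)) (L.bracket (ι.toLin (ospH F)) (L.bracket (ι.toLin (ospH F)) z)) -
    (4 : F) • L.bracket (ι.toLin (ospH F)) (L.bracket (ι.toLin (ospH F)) z) -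
    (4 : F) • L.bracket (ι.toLin (ospH F)) z))) +
    (L.bracket (ι.toLin (ospH F)) (L.bracket (ι.toLin (ospH F))
      (L.bracket (ι.toLin (ospH F)) (L.bracket (ι.toLin (ospH F)) z))) +
    L.bracket (ι.toLin (ospH F)) (L.bracket (ι.toLin (ospH F)) (L.bracket (ι.toLin (ospH F)) z)) -
    (4 : F) • L.bracket (ι.toLin (ospH F)) (L.bracket (ι.toLin (ospH F)) z) -
    (4 : F) • L.bracket (ι.toLin (ospH F)) z) = 0 := by
  induction z using hg.induction with
  | hadd x y hx hy =>
    simp only [map_add, map_sub, map_smul] at hx hy ⊢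
    linear_combination (norm := module) hx + hy
  | hf S hS f hf s =>
    simp only [hf.bracket hS, hf.weyl hS, ← map_add, ← map_sub, ← map_smul]
    refine (congrArg f (Subtype.ext ?_)).trans (map_zero f)
    simp only [coe_ospAct, Submodule.coe_add, Submodule.coe_sub, Submodule.coe_smul,
      coe_ospWeyl hS h2, phiGl_apply, gl_bracket_ospH, gl_bracket_ospX]
    ext i j
    fin_cases i <;> fin_cases j <;> simp [-mul_eq_zero, -mul_eq_mul_left_iff] <;> ring
  | hd d hd =>
    have hd' : ∀ m : osp12 F, L.bracket (ι.toLin m) d = 0 := hd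
    simp [hd']

/-- In osp(1,2) and s the even part has weights among 0, 2, -2 and the odd part has weights 1, -1.
The centralizer may have both parities, but its weight 0 satisfies both equations. -/
theorem exists_parity_weights (z : g) : ∃ x ∈ L.homog 0, ∃ y ∈ L.homog 1, x + y = z ∧
    L.bracket (ι.toLin (ospH F)) (L.bracket (ι.toLin (ospH F)) (L.bracket (ι.toLin (ospH F)) x)) =
      (4 : F) • L.bracket (ι.toLin (ospH F)) x ∧
    L.bracket (ι.toLin (ospH F)) (L.bracket (ι.toLin (ospH F)) (L.bracket (ι.toLin (ospH F)) y)) =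
      L.bracket (ι.toLin (ospH F)) y := by
  induction z using hg.induction with
  | hadd x y hx hy =>
    obtain ⟨x0, hx0, x1, hx1, rfl, hx2, hx3⟩ := hx
    obtain ⟨y0, hy0, y1, hy1, rfl, hy2, hy3⟩ := hy
    exact ⟨x0 + y0, add_mem hx0 hy0, x1 + y1, add_mem hx1 hy1, by abel,
      by simp only [map_add, smul_add, hx2, hy2], by simp only [map_add, hx3, hy3]⟩
  | hf S hS f hf s =>
    have key : ∃ x y : S, x.1 ∈ (gl12 F).homog 0 ∧ y.1 ∈ (gl12 F).homog 1 ∧ x + y = s := by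
      obtain ⟨x, hx, y, hy, e⟩ := Submodule.mem_sup.1 (hS.graded s.2)
      exact ⟨⟨x, hx.1⟩, ⟨y, hy.1⟩, hx.2, hy.2, Subtype.ext e⟩
    obtain ⟨x, y, hx, hy, rfl⟩ := key
    refine ⟨f x, hf.1 0 x hx, f y, hf.1 1 y hy, (map_add f x y).symm, ?_, ?_⟩
    · simp only [hf.bracket hS, ← map_smul]
      congr 1
      ext i j
      have h1 := hx 0 1 (by decide)
      have h2 := hx 0 2 (by decide)
      have h3 := hx 1 0 (by decide)
      have h4 := hx 2 0 (by decide)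
      simp only [coe_ospAct, Submodule.coe_smul, gl_bracket_ospH]
      fin_cases i <;> fin_cases j <;> simp [h1, h2, h3, h4, -mul_eq_mul_left_iff] <;> ring
    · simp only [hf.bracket hS]
      congr 1
      ext i j
      have h1 := hy 1 2 (by decide)
      have h2 := hy 2 1 (by decide)
      simp only [coe_ospAct, gl_bracket_ospH]
      fin_cases i <;> fin_cases j <;> simp [h1, h2]
  | hd d hd =>
    obtain ⟨x, hx, y, hy, rfl⟩ := L.exists_add_homog d
    have hH : ι.toLin (ospH F) ∈ L.homog 0 := isIntertwiner_toLin.1 0 (ospH F) ospH_mem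
    have e : L.bracket (ι.toLin (ospH F)) (x + y) = 0 := hd _
    rw [map_add] at e
    have e0 : L.bracket (ι.toLin (ospH F)) x = 0 := by
      refine L.eq_zero_of_mem (L.bracket_even_mem hH hx) ?_
      rw [eq_neg_of_add_eq_zero_left e]
      exact neg_mem (L.bracket_even_mem hH hy)
    rw [e0, zero_add] at e
    exact ⟨x, hx, y, hy, rfl, by simp [e0], by simp [e]⟩

end IsStrictGrading
end B01Embedding

/-- Highest weights of `sl(2)`-modules on which the cube of the lowering operator vanishes. -/
theorem sl2_highest_weight {F M : Type*} [Field F] [AddCommGroup M] [Module F M]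
    {e f h : Module.End F M} (hef : ∀ z, e (f z) = f (e z) + h z)
    (hhf : ∀ z, h (f z) = f (h z) - (2 : F) • f z) (hf : ∀ z, f (f (f z)) = 0)
    {c : F} {z : M} (he : e z = 0) (hh : h z = c • z) :
    (6 * c * (c - 1) * (c - 2)) • z = 0 := by
  have h1 : h (f z) = (c - 2) • f z := by rw [hhf, hh, map_smul]; module
  have h2 : h (f (f z)) = (c - 4) • f (f z) := by rw [hhf, h1, map_smul]; module
  have e1 : e (f z) = c • z := by rw [hef, he, hh, map_zero, zero_add]
  have e2 : e (f (f z)) = (2 * c - 2) • f z := by rw [hef, e1, h1, map_smul]; module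
  have e3 : e (f (f (f z))) = (3 * c - 6) • f (f z) := by rw [hef, e2, h2, map_smul]; module
  rw [hf, map_zero] at e3
  -- With e f^k z = k(c - k + 1) f^(k-1) z, this reads 0 = e³f³z = (3c - 6)(2c - 2)c z.
  have e4 := congrArg e (congrArg e e3)
  simp only [map_zero, map_smul, e2, e1] at e4
  rw [e4]
  module

/-! ### The `5`-grading -/

namespace B01Embedding

variable {F : Type u} [Field F] {g : Type v} [AddCommGroup g] [Module F g]
  {L : LieSuperalgebra F g} {ι : B01Embedding L}

variable (ι) in
theorem ospH_mem_homog : ι.toLin (ospH F) ∈ L.homog 0 := isIntertwiner_toLin.1 0 _ ospH_mem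

variable (ι) in
theorem ospE_mem_homog : ι.toLin (ospE F) ∈ L.homog 0 := isIntertwiner_toLin.1 0 _ ospE_mem

variable (ι) in
theorem ospF_mem_homog : ι.toLin (ospF F) ∈ L.homog 0 := isIntertwiner_toLin.1 0 _ ospF_mem

theorem IsIntertwiner.bracket_eq {S : Submodule F (Matrix (Fin 3) (Fin 3) F)} {f : S →ₗ[F] g}
    (hf : ι.IsIntertwiner f) (m : osp12 F) (s : S) (c : F) (t : S)
    (h : c • t.1 = (gl12 F).bracket m.1 s.1) : L.bracket (ι.toLin m) (f s) = c • f t := by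
  rw [← map_smul]
  exact (hf.2 m s _ h).symm

variable (ι) in
theorem bracket_ospE_ospF :
    L.bracket (ι.toLin (ospE F)) (ι.toLin (ospF F)) = ι.toLin (ospH F) := by
  rw [isIntertwiner_toLin.bracket_eq (ospE F) (ospF F) 1 (ospH F), one_smul]
  rw [gl_bracket_ospE]
  ext i j; fin_cases i <;> fin_cases j <;> simp [ospF, ospH]

variable (ι) in
theorem bracket_ospH_ospE :
    L.bracket (ι.toLin (ospH F)) (ι.toLin (ospE F)) = (2 : F) • ι.toLin (ospE F) := by
  rw [isIntertwiner_toLin.bracket_eq (ospH F) (ospE F) 2 (ospE F)]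
  rw [gl_bracket_ospH]
  ext i j; fin_cases i <;> fin_cases j <;> simp [ospE]

variable (ι) in
theorem bracket_ospH_ospF :
    L.bracket (ι.toLin (ospH F)) (ι.toLin (ospF F)) = (-2 : F) • ι.toLin (ospF F) := by
  rw [isIntertwiner_toLin.bracket_eq (ospH F) (ospF F) (-2) (ospF F)]
  rw [gl_bracket_ospH]
  ext i j; fin_cases i <;> fin_cases j <;> simp [ospF]

theorem mem_grade {i : ℤ} (hi : -2 ≤ i ∧ i ≤ 2) {z : g} :
    z ∈ ι.grade i ↔ L.bracket (ι.toLin (ospH F)) z = (i : F) • z := by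
  rw [grade, LieSuperalgebra.adGrade, if_pos hi]
  simp [sub_eq_zero]

theorem grade_eq_bot {i : ℤ} (hi : ¬(-2 ≤ i ∧ i ≤ 2)) : ι.grade i = ⊥ := by
  rw [grade, LieSuperalgebra.adGrade, if_neg hi]

/-- Differences of such integers are at most 4 in absolute value, so their only prime factors are 2
and 3. -/
theorem intCast_injOn_Icc (h2 : (2 : F) ≠ 0) (h3 : (3 : F) ≠ 0) :
    Set.InjOn (fun i : ℤ => (i : F)) {i | -2 ≤ i ∧ i ≤ 2} := by
  have h4 : (4 : F) ≠ 0 := by rw [show (4 : F) = 2 * 2 by norm_num]; exact mul_ne_zero h2 h2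
  rintro i ⟨hi, hi'⟩ j ⟨hj, hj'⟩ h
  have h' : ((i - j : ℤ) : F) = 0 := by simpa [sub_eq_zero] using h
  obtain ⟨k, hk⟩ : ∃ k, k = i - j := ⟨_, rfl⟩
  rw [← hk] at h'
  have hk1 : -4 ≤ k := by omega
  have hk2 : k ≤ 4 := by omega
  by_contra hij
  have hk0 : k ≠ 0 := by omega
  clear hk
  interval_cases k <;> first | exact hk0 rfl | simp [h2, h3, h4] at h'

namespace IsStrictGrading

variable (hg : ι.IsStrictGrading)
include hg

theorem bracket_ospE_eq_zero (h2 : (2 : F) ≠ 0) (h3 : (3 : F) ≠ 0) {i : ℤ} (hi : 1 ≤ i) {z : g}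
    (hz : z ∈ ι.grade i) : L.bracket (ι.toLin (ospE F)) z = 0 := by
  have h6 : (6 : F) ≠ 0 := by rw [show (6 : F) = 2 * 3 by norm_num]; exact mul_ne_zero h2 h3
  by_cases hi' : i ≤ 2
  · have e := hg.bracket_ospE_weights z
    rw [mem_grade ⟨by omega, hi'⟩] at hz
    simp only [hz, map_smul, ← add_smul, smul_smul] at e
    refine (smul_eq_zero.1 e).resolve_left ?_
    interval_cases i
    · norm_num; exact h6
    · norm_num
      rw [show (24 : F) = 2 * 2 * 6 by norm_num]
      exact mul_ne_zero (mul_ne_zero h2 h2) h6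
  · rw [grade_eq_bot (by omega), Submodule.mem_bot] at hz
    rw [hz, map_zero]

theorem bracket_ospF_eq_zero (h2 : (2 : F) ≠ 0) (h3 : (3 : F) ≠ 0) {i : ℤ} (hi : i ≤ -1) {z : g}
    (hz : z ∈ ι.grade i) : L.bracket (ι.toLin (ospF F)) z = 0 := by
  have h6 : (6 : F) ≠ 0 := by rw [show (6 : F) = 2 * 3 by norm_num]; exact mul_ne_zero h2 h3
  by_cases hi' : -2 ≤ i
  · have e := hg.bracket_ospF_weights z
    rw [mem_grade ⟨hi', by omega⟩] at hz
    simp only [hz, map_smul, ← add_smul, ← sub_smul, smul_smul] at e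
    refine (smul_eq_zero.1 e).resolve_left ?_
    interval_cases i
    · norm_num
      rw [show (24 : F) = 2 * 2 * 6 by norm_num]
      exact mul_ne_zero (mul_ne_zero h2 h2) h6
    · norm_num; exact h6
  · rw [grade_eq_bot (by omega), Submodule.mem_bot] at hz
    rw [hz, map_zero]

theorem eq_zero_of_highest (h2 : (2 : F) ≠ 0) (h3 : (3 : F) ≠ 0) {z : g} {c : F}
    (hE : L.bracket (ι.toLin (ospE F)) z = 0) (hH : L.bracket (ι.toLin (ospH F)) z = c • z)
    (hc : c * (c - 1) * (c - 2) ≠ 0) : z = 0 := by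
  have h6 : (6 : F) ≠ 0 := by rw [show (6 : F) = 2 * 3 by norm_num]; exact mul_ne_zero h2 h3
  have := sl2_highest_weight (e := L.bracket (ι.toLin (ospE F)))
    (f := L.bracket (ι.toLin (ospF F))) (h := L.bracket (ι.toLin (ospH F)))
    (fun z => by rw [L.bracket_even ι.ospE_mem_homog, ι.bracket_ospE_ospF, add_comm])
    (fun z => by
      rw [L.bracket_even ι.ospH_mem_homog, ι.bracket_ospH_ospF, map_smul, LinearMap.smul_apply]
      module) hg.bracket_ospF_cube hE hH
  refine (smul_eq_zero.1 this).resolve_left ?_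
  rw [mul_assoc, mul_assoc, ← mul_assoc c]
  exact mul_ne_zero h6 hc

/-- The triple (F, E, -H) satisfies the same relations as (E, F, H). -/
theorem eq_zero_of_lowest (h2 : (2 : F) ≠ 0) (h3 : (3 : F) ≠ 0) {z : g} {c : F}
    (hE : L.bracket (ι.toLin (ospF F)) z = 0) (hH : L.bracket (ι.toLin (ospH F)) z = -c • z)
    (hc : c * (c - 1) * (c - 2) ≠ 0) : z = 0 := by
  have h6 : (6 : F) ≠ 0 := by rw [show (6 : F) = 2 * 3 by norm_num]; exact mul_ne_zero h2 h3
  have := sl2_highest_weight (e := L.bracket (ι.toLin (ospF F)))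
    (f := L.bracket (ι.toLin (ospE F))) (h := -L.bracket (ι.toLin (ospH F)))
    (fun z => by
      rw [L.bracket_even ι.ospF_mem_homog, L.skew_even ι.ospF_mem_homog, ι.bracket_ospE_ospF,
        add_comm, map_neg, LinearMap.neg_apply])
    (fun z => by
      rw [LinearMap.neg_apply, L.bracket_even ι.ospH_mem_homog, ι.bracket_ospH_ospE, map_smul,
        LinearMap.smul_apply, LinearMap.neg_apply, map_neg]
      module) hg.bracket_ospE_cube hE (c := c) (by rw [LinearMap.neg_apply, hH]; module)
  refine (smul_eq_zero.1 this).resolve_left ?_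
  rw [mul_assoc, mul_assoc, ← mul_assoc c]
  exact mul_ne_zero h6 hc

/-- Eigenvalues alone do not suffice when `i + j` leaves the range, since 3 = -2 and 4 = -1 in
characteristic 5. In that case `i` and `j` are nonzero of the same sign, so `x`, `y` and their
bracket are killed by ad E (or ad F), and the highest (or lowest) weight argument applies. -/
theorem grade_bracket_mem (h2 : (2 : F) ≠ 0) (h3 : (3 : F) ≠ 0) {i j : ℤ} {x y : g}
    (hx : x ∈ ι.grade i) (hy : y ∈ ι.grade j) : L.bracket x y ∈ ι.grade (i + j) := by
  by_cases hi : -2 ≤ i ∧ i ≤ 2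
  swap
  · rw [grade_eq_bot hi, Submodule.mem_bot] at hx
    rw [hx, map_zero, LinearMap.zero_apply]
    exact zero_mem _
  by_cases hj : -2 ≤ j ∧ j ≤ 2
  swap
  · rw [grade_eq_bot hj, Submodule.mem_bot] at hy
    rw [hy, map_zero]
    exact zero_mem _
  have hH : L.bracket (ι.toLin (ospH F)) (L.bracket x y) = ((i + j : ℤ) : F) • L.bracket x y := by
    rw [L.bracket_even ι.ospH_mem_homog, (mem_grade hi).1 hx, (mem_grade hj).1 hy]
    simp only [map_smul, LinearMap.smul_apply]
    push_cast
    module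
  by_cases hk : -2 ≤ i + j ∧ i + j ≤ 2
  · exact (mem_grade hk).2 hH
  suffices h0 : L.bracket x y = 0 by rw [h0]; exact zero_mem _
  have h6 : (6 : F) ≠ 0 := by rw [show (6 : F) = 2 * 3 by norm_num]; exact mul_ne_zero h2 h3
  have h24 : (24 : F) ≠ 0 := by
    rw [show (24 : F) = 2 * 2 * 6 by norm_num]
    exact mul_ne_zero (mul_ne_zero h2 h2) h6
  rcases lt_or_ge 0 (i + j) with h | h
  · refine hg.eq_zero_of_highest h2 h3 ?_ hH ?_
    · rw [L.bracket_even ι.ospE_mem_homog, hg.bracket_ospE_eq_zero h2 h3 (by omega) hx,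
        hg.bracket_ospE_eq_zero h2 h3 (by omega) hy]
      simp
    · have : i + j = 3 ∨ i + j = 4 := by omega
      rcases this with e | e <;> rw [e] <;> norm_num <;> assumption
  · refine hg.eq_zero_of_lowest h2 h3 (c := ((-(i + j) : ℤ) : F)) ?_ ?_ ?_
    · rw [L.bracket_even ι.ospF_mem_homog, hg.bracket_ospF_eq_zero h2 h3 (by omega) hx,
        hg.bracket_ospF_eq_zero h2 h3 (by omega) hy]
      simp
    · rw [hH]; push_cast; module
    · have : -(i + j) = 3 ∨ -(i + j) = 4 := by omega
      rcases this with e | e <;> rw [e] <;> norm_num <;> assumption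

theorem iSup_grade (h2 : (2 : F) ≠ 0) (h3 : (3 : F) ≠ 0) : ⨆ i, ι.grade i = ⊤ := by
  rw [eq_top_iff]
  intro z _
  have h24 : (24 : F) ≠ 0 := by
    rw [show (24 : F) = 2 * 2 * (2 * 3) by norm_num]
    exact mul_ne_zero (mul_ne_zero h2 h2) (mul_ne_zero h2 h3)
  have h5 := hg.bracket_ospH_weights z
  set h := L.bracket (ι.toLin (ospH F)) with hh
  -- Lagrange interpolation at 0, 1, -1, 2, -2, with denominators cleared by 24: each summand is a
  -- multiple of the product of the `h - j` over the other four nodes `j`.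
  have key : (24 : F) • z =
      ((24 : F) • z - (30 : F) • h (h z) + (6 : F) • h (h (h (h z)))) +
      (-4 : F) • (h (h (h (h z))) + h (h (h z)) - (4 : F) • h (h z) - (4 : F) • h z) +
      (-4 : F) • (h (h (h (h z))) - h (h (h z)) - (4 : F) • h (h z) + (4 : F) • h z) +
      (h (h (h (h z))) + (2 : F) • h (h (h z)) - h (h z) - (2 : F) • h z) +
      (h (h (h (h z))) - (2 : F) • h (h (h z)) - h (h z) + (2 : F) • h z) := by module
  have hz : z = (24 : F)⁻¹ • (24 : F) • z := by rw [smul_smul, inv_mul_cancel₀ h24, one_smul]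
  rw [hz]
  refine Submodule.smul_mem _ _ ?_
  rw [key]
  refine add_mem (add_mem (add_mem (add_mem ?_ (Submodule.smul_mem _ _ ?_))
    (Submodule.smul_mem _ _ ?_)) ?_) ?_
  · refine Submodule.mem_iSup_of_mem 0 ((mem_grade (by norm_num)).2 ?_)
    simp only [← hh, map_add, map_sub, map_smul]
    push_cast
    linear_combination (norm := module) (6 : F) • h5
  · refine Submodule.mem_iSup_of_mem 1 ((mem_grade (by norm_num)).2 ?_)
    simp only [← hh, map_add, map_sub, map_smul]
    push_cast
    linear_combination (norm := module) h5
  · refine Submodule.mem_iSup_of_mem (-1) ((mem_grade (by norm_num)).2 ?_)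
    simp only [← hh, map_add, map_sub, map_smul]
    push_cast
    linear_combination (norm := module) h5
  · refine Submodule.mem_iSup_of_mem 2 ((mem_grade (by norm_num)).2 ?_)
    simp only [← hh, map_add, map_sub, map_smul]
    push_cast
    linear_combination (norm := module) h5
  · refine Submodule.mem_iSup_of_mem (-2) ((mem_grade (by norm_num)).2 ?_)
    simp only [← hh, map_add, map_sub, map_smul]
    push_cast
    linear_combination (norm := module) h5

omit hg in
theorem iSupIndep_grade (h2 : (2 : F) ≠ 0) (h3 : (3 : F) ≠ 0) : iSupIndep ι.grade := by
  -- The map from integers to eigenvalues need not be injective; it is so on the indices of nonzero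
  -- components.
  rw [← iSupIndep_ne_bot]
  have hr : ∀ i : {i // ι.grade i ≠ ⊥}, -2 ≤ i.1 ∧ i.1 ≤ 2 := fun i => by
    by_contra h
    exact i.2 (grade_eq_bot h)
  have := (Module.End.eigenspaces_iSupIndep (L.bracket (ι.toLin (ospH F)))).comp
    (f := fun i : {i // ι.grade i ≠ ⊥} => ((i : ℤ) : F))
    (fun i j h => Subtype.ext (intCast_injOn_Icc h2 h3 (hr i) (hr j) h))
  convert this using 2 with i
  ext z
  rw [mem_grade (hr i), Function.comp_apply, Module.End.mem_eigenspace_iff]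

theorem isFiveGrading (h2 : (2 : F) ≠ 0) (h3 : (3 : F) ≠ 0) : L.IsFiveGrading ι.grade where
  isInternal := (DirectSum.isInternal_submodule_iff_iSupIndep_and_iSup_eq_top _).2
    ⟨iSupIndep_grade h2 h3, hg.iSup_grade h2 h3⟩
  bracket_mem _ _ _ _ := hg.grade_bracket_mem h2 h3
  eq_bot _ := grade_eq_bot

end IsStrictGrading
end B01Embedding

/-! ### Freudenthal–Kantor triple systems from automorphisms -/

namespace LieSuperalgebra

variable {F : Type*} [Field F] {g : Type*} [AddCommGroup g] [Module F g]

/-- The triple product `[[x, φ y], z]` on a subspace closed under it. -/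
def tripleProduct (L : LieSuperalgebra F g) (φ : Module.End F g) (U : Submodule F g)
    (hU : ∀ x ∈ U, ∀ y ∈ U, ∀ z ∈ U, L.bracket (L.bracket x (φ y)) z ∈ U) :
    U →ₗ[F] U →ₗ[F] U →ₗ[F] U :=
  LinearMap.mk₂ F
    (fun x y => (L.bracket (L.bracket x.1 (φ y.1))).restrict (hU x.1 x.2 y.1 y.2))
    (fun x y z => by ext; simp) (fun c x y => by ext; simp)
    (fun x y z => by ext; simp) (fun c x y => by ext; simp)

variable {L : LieSuperalgebra F g} {φ : Module.End F g} {U : Submodule F g}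

theorem coe_tripleProduct (hU : ∀ x ∈ U, ∀ y ∈ U, ∀ z ∈ U, L.bracket (L.bracket x (φ y)) z ∈ U)
    (x y z : U) : (L.tripleProduct φ U hU x y z : g) = L.bracket (L.bracket x.1 (φ y.1)) z.1 := rfl

/-- The first identity says that the even element [u, φ v] acts as a derivation; the sign in its
second term comes from [[u, φ v], φ y] = -φ[[v, φ u], y], where φ² = -1 enters. The second is the
derivation rule for the even element [u, v], which kills `U`. -/
theorem isFreudenthalKantor_tripleProduct
    (hU : ∀ x ∈ U, ∀ y ∈ U, ∀ z ∈ U, L.bracket (L.bracket x (φ y)) z ∈ U)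
    (hodd : ∀ x ∈ U, x ∈ L.homog 1) (hφodd : ∀ x ∈ U, φ x ∈ L.homog 1)
    (hφ : ∀ x y, φ (L.bracket x y) = L.bracket (φ x) (φ y))
    (hφφ : ∀ x ∈ U, φ (φ x) = -x)
    (hzero : ∀ x ∈ U, ∀ y ∈ U, ∀ z ∈ U, L.bracket (L.bracket x y) z = 0) :
    IsFreudenthalKantor (-1) (-1) (L.tripleProduct φ U hU) := by
  have hev : ∀ x y : U, L.bracket x.1 (φ y.1) ∈ L.homog 0 :=
    fun x y => L.bracket_odd_odd (hodd x x.2) (hφodd y y.2)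
  have hflip : ∀ u v y : U, L.bracket (L.bracket u.1 (φ v.1)) (φ y.1) =
      -φ (L.bracket (L.bracket v.1 (φ u.1)) y.1) := fun u v y => by
    rw [hφ, hφ, hφφ u u.2, map_neg, map_neg, LinearMap.neg_apply, neg_neg,
      L.symm_odd (hφodd v v.2) (hodd u u.2)]
  -- Jacobi for the odd elements `u` and `v` turns the symmetric sum defining K into the action of
  -- [u, v].
  have hK : ∀ u v z : U, (fkK (-1) (L.tripleProduct φ U hU) u v z : g) =
      -L.bracket (L.bracket u.1 v.1) (φ z.1) := fun u v z => by
    have e := L.bracket_odd (hodd u u.2) (hodd v v.2) (φ z.1)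
    simp only [fkK, LinearMap.sub_apply, LinearMap.smul_apply, LinearMap.flip_apply,
      Submodule.coe_sub, Submodule.coe_smul, coe_tripleProduct, L.skew_even (hev u z) v.1,
      L.skew_even (hev v z) u.1, e]
    module
  refine ⟨Or.inr rfl, Or.inr rfl, fun u v x y => ?_, fun u v x y => ?_⟩
  · ext z
    simp only [LinearMap.sub_apply, LinearMap.add_apply, LinearMap.smul_apply,
      LinearMap.comp_apply, Submodule.coe_sub, Submodule.coe_add, Submodule.coe_smul,
      coe_tripleProduct]
    rw [L.bracket_even (hev u v) (L.bracket x.1 (φ y.1)) z.1,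
      L.bracket_even (hev u v) x.1 (φ y.1), hflip]
    simp only [map_neg, map_add, LinearMap.neg_apply, LinearMap.add_apply]
    module
  · ext z
    have hE : L.bracket u.1 v.1 ∈ L.homog 0 := L.bracket_odd_odd (hodd u u.2) (hodd v v.2)
    have e1 : L.bracket (L.bracket (L.bracket u.1 v.1) (φ x.1)) y.1 =
        L.bracket (L.bracket u.1 v.1) (L.bracket y.1 (φ x.1)) := by
      have := L.bracket_even hE (φ x.1) y.1
      rw [hzero u.1 u.2 v.1 v.2 y.1 y.2, map_zero, add_zero] at this
      rw [← this, L.symm_odd (hφodd x x.2) (hodd y y.2)]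
    have e2 := L.bracket_even hE (L.bracket y.1 (φ x.1)) (φ z.1)
    rw [hflip] at e2
    simp only [LinearMap.sub_apply, LinearMap.smul_apply, LinearMap.comp_apply,
      Submodule.coe_sub, Submodule.coe_smul, coe_tripleProduct, hK, map_neg,
      LinearMap.neg_apply, e1] at e2 ⊢
    linear_combination (norm := module) -e2

end LieSuperalgebra

/-! ### The Weyl automorphism and the triple system on `g_1` -/

namespace B01Embedding

variable {F : Type u} [Field F] {g : Type v} [AddCommGroup g] [Module F g]
  {L : LieSuperalgebra F g} {ι : B01Embedding L}

theorem expCube_mem_homog {D : Module.End F g} {i : ZMod 2}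
    (hD : ∀ x ∈ L.homog i, D x ∈ L.homog i) : ∀ x ∈ L.homog i, expCube D x ∈ L.homog i :=
  fun x hx => add_mem (add_mem hx (hD x hx)) (Submodule.smul_mem _ _ (hD _ (hD x hx)))

theorem weyl_mem_homog {i : ZMod 2} {x : g} (hx : x ∈ L.homog i) : ι.weyl x ∈ L.homog i := by
  have hE : ∀ x ∈ L.homog i, (-L.bracket (ι.toLin (ospE F))) x ∈ L.homog i :=
    fun x hx => neg_mem (L.bracket_even_mem ι.ospE_mem_homog hx)
  have hF : ∀ x ∈ L.homog i, L.bracket (ι.toLin (ospF F)) x ∈ L.homog i :=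
    fun x hx => L.bracket_even_mem ι.ospF_mem_homog hx
  exact expCube_mem_homog hE _ (expCube_mem_homog hF _ (expCube_mem_homog hE _ hx))

theorem bracket_ospX_ospY :
    L.bracket (ι.toLin (ospX F)) (ι.toLin (ospY F)) = ι.toLin (ospH F) := by
  rw [isIntertwiner_toLin.bracket_eq (ospX F) (ospY F) 1 (ospH F), one_smul]
  rw [gl_bracket_ospX]
  ext i j; fin_cases i <;> fin_cases j <;> simp [ospY, ospH]

theorem weyl_ospX (h2 : (2 : F) ≠ 0) : ι.weyl (ι.toLin (ospX F)) = ι.toLin (ospY F) := by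
  rw [isIntertwiner_toLin.weyl osp12_stable]
  congr 1
  ext i j
  rw [coe_ospWeyl _ h2, phiGl_apply]
  fin_cases i <;> fin_cases j <;> simp [ospX, ospY]

theorem weyl_ospH (h2 : (2 : F) ≠ 0) : ι.weyl (ι.toLin (ospH F)) = -ι.toLin (ospH F) := by
  rw [isIntertwiner_toLin.weyl osp12_stable, ← map_neg]
  congr 1
  ext i j
  rw [coe_ospWeyl _ h2, phiGl_apply]
  fin_cases i <;> fin_cases j <;> simp [ospH]

theorem ospX_mem_grade : ι.toLin (ospX F) ∈ ι.grade 1 := by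
  rw [mem_grade (by norm_num), isIntertwiner_toLin.bracket_eq (ospH F) (ospX F) 1 (ospX F)]
  · simp
  rw [gl_bracket_ospH]
  ext i j; fin_cases i <;> fin_cases j <;> simp [ospX]

namespace IsStrictGrading

variable (hg : ι.IsStrictGrading)
include hg

theorem weyl_bracket (h2 : (2 : F) ≠ 0) (h3 : (3 : F) ≠ 0) (x y : g) :
    ι.weyl (L.bracket x y) = L.bracket (ι.weyl x) (ι.weyl y) := by
  have hE := L.expCube_bracket h2 h3 (-L.bracket (ι.toLin (ospE F)))
    (fun x y => by
      simp only [LinearMap.neg_apply, map_neg, L.bracket_even ι.ospE_mem_homog x y, neg_add])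
    (fun x => by simp [hg.bracket_ospE_cube x])
  have hF := L.expCube_bracket h2 h3 (L.bracket (ι.toLin (ospF F)))
    (fun x y => L.bracket_even ι.ospF_mem_homog x y) hg.bracket_ospF_cube
  simp only [weyl, Module.End.mul_apply, hE, hF]

/-- The even component of `x` also has weight 1, while H³ = 4H holds on it; hence three times this
component is zero. -/
theorem grade_one_odd (h3 : (3 : F) ≠ 0) {x : g} (hx : x ∈ ι.grade 1) : x ∈ L.homog 1 := by
  obtain ⟨y, hy, z, hz, rfl, e, -⟩ := hg.exists_parity_weights x
  rw [mem_grade (by norm_num), map_add, Int.cast_one, one_smul] at hx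
  have e0 : L.bracket (ι.toLin (ospH F)) y = y := by
    rw [← sub_eq_zero]
    refine L.eq_zero_of_mem (sub_mem (L.bracket_even_mem ι.ospH_mem_homog hy) hy) ?_
    -- The even element [H, y] - y equals the odd element z - [H, z].
    rw [sub_eq_sub_iff_add_eq_add.2 (hx.trans (add_comm y z))]
    exact sub_mem hz (L.bracket_even_mem ι.ospH_mem_homog hz)
  rw [e0, e0, e0] at e
  have h : (3 : F) • y = 0 := by linear_combination (norm := module) -e
  rw [(smul_eq_zero.1 h).resolve_left h3, zero_add]
  exact hz

theorem weyl_mem_grade (h2 : (2 : F) ≠ 0) (h3 : (3 : F) ≠ 0) {x : g} (hx : x ∈ ι.grade 1) :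
    ι.weyl x ∈ ι.grade (-1) := by
  rw [mem_grade (by norm_num)] at hx ⊢
  have e := congrArg ι.weyl hx
  rw [hg.weyl_bracket h2 h3, weyl_ospH h2, map_neg, LinearMap.neg_apply, map_smul] at e
  rw [← neg_eq_iff_eq_neg.2 (neg_neg _).symm, ← neg_inj, e]
  simp

theorem weyl_weyl_of_mem (h2 : (2 : F) ≠ 0) (h3 : (3 : F) ≠ 0) {x : g} (hx : x ∈ ι.grade 1) :
    ι.weyl (ι.weyl x) = -x := by
  rw [mem_grade (by norm_num), Int.cast_one, one_smul] at hx
  have e := hg.weyl_weyl h2 x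
  simp only [hx, map_sub, map_smul] at e
  have h : (3 : F) • (ι.weyl (ι.weyl x) + x) = 0 := by linear_combination (norm := module) -e
  exact eq_neg_of_add_eq_zero_left ((smul_eq_zero.1 h).resolve_left h3)

theorem bracket_ospX_ospX_weyl_of_mem (h2 : (2 : F) ≠ 0) (h3 : (3 : F) ≠ 0) {x : g}
    (hx : x ∈ ι.grade 1) :
    L.bracket (ι.toLin (ospX F)) (L.bracket (ι.toLin (ospX F)) (ι.weyl x)) = -x := by
  rw [mem_grade (by norm_num), Int.cast_one, one_smul] at hx
  have e := hg.bracket_ospX_ospX_weyl h2 x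
  simp only [hx, map_sub, map_add, map_smul] at e
  have h : (6 : F) • (L.bracket (ι.toLin (ospX F)) (L.bracket (ι.toLin (ospX F)) (ι.weyl x)) + x)
    = 0 := by linear_combination (norm := module) -e
  have h6 : (6 : F) ≠ 0 := by rw [show (6 : F) = 2 * 3 by norm_num]; exact mul_ne_zero h2 h3
  exact eq_neg_of_add_eq_zero_left ((smul_eq_zero.1 h).resolve_left h6)

theorem tripleProduct_mem (h2 : (2 : F) ≠ 0) (h3 : (3 : F) ≠ 0) : ∀ x ∈ ι.grade 1,
    ∀ y ∈ ι.grade 1, ∀ z ∈ ι.grade 1, L.bracket (L.bracket x (ι.weyl y)) z ∈ ι.grade 1 :=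
  fun _ hx _ hy _ hz => hg.grade_bracket_mem h2 h3
    (hg.grade_bracket_mem h2 h3 hx (hg.weyl_mem_grade h2 h3 hy)) hz

theorem isFreudenthalKantor (h2 : (2 : F) ≠ 0) (h3 : (3 : F) ≠ 0) :
    IsFreudenthalKantor (-1) (-1)
      (L.tripleProduct ι.weyl (ι.grade 1) (hg.tripleProduct_mem h2 h3)) := by
  refine LieSuperalgebra.isFreudenthalKantor_tripleProduct _ (fun x hx => hg.grade_one_odd h3 hx)
    (fun x hx => weyl_mem_homog (hg.grade_one_odd h3 hx)) (hg.weyl_bracket h2 h3)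
    (fun x hx => hg.weyl_weyl_of_mem h2 h3 hx) (fun x hx y hy z hz => ?_)
  have := hg.grade_bracket_mem h2 h3 (hg.grade_bracket_mem h2 h3 hx hy) hz
  rwa [grade_eq_bot (by norm_num), Submodule.mem_bot] at this

theorem isLeftUnit (h2 : (2 : F) ≠ 0) (h3 : (3 : F) ≠ 0) :
    IsLeftUnit (L.tripleProduct ι.weyl (ι.grade 1) (hg.tripleProduct_mem h2 h3))
      ⟨ι.toLin (ospX F), ospX_mem_grade⟩ := by
  intro x
  ext
  have hx := (mem_grade (by norm_num)).1 x.2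
  rw [LieSuperalgebra.coe_tripleProduct, weyl_ospX h2, bracket_ospX_ospY, hx]
  simp

theorem tripleProduct_unit (h2 : (2 : F) ≠ 0) (h3 : (3 : F) ≠ 0) (x : ι.grade 1) :
    L.tripleProduct ι.weyl (ι.grade 1) (hg.tripleProduct_mem h2 h3)
      ⟨ι.toLin (ospX F), ospX_mem_grade⟩ x ⟨ι.toLin (ospX F), ospX_mem_grade⟩ = x := by
  ext
  have hX := hg.grade_one_odd h3 (ospX_mem_grade (ι := ι))
  rw [LieSuperalgebra.coe_tripleProduct,
    L.skew_even (L.bracket_odd_odd hX (weyl_mem_homog (hg.grade_one_odd h3 x.2))),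
    hg.bracket_ospX_ospX_weyl_of_mem h2 h3 x.2, neg_neg]

end IsStrictGrading
end B01Embedding

/-! ### Weight bases of `osp(1,2)` and of its natural module -/

section Bases

variable {F : Type*} [Field F]

/-- The vector of weight `1` of `natS`. -/
def natSU (F : Type*) [Field F] : natS F :=
  ⟨!![0, 0, 1; 1, 0, 0; 0, 0, 0], 0, 0, 1, by simp⟩

/-- The vector of weight `0` of `natS`. -/
def natSV (F : Type*) [Field F] : natS F :=
  ⟨!![2, 0, 0; 0, 1, 0; 0, 0, 1], 1, 0, 0, by simp⟩

/-- The vector of weight `-1` of `natS`. -/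
def natSW (F : Type*) [Field F] : natS F :=
  ⟨!![0, 1, 0; 0, 0, 0; -1, 0, 0], 0, 1, 0, by simp⟩

theorem osp12_eq_sum (m : osp12 F) : ∃ a b c d e : F,
    m = a • ospE F + b • ospX F + c • ospH F + d • ospY F + e • ospF F := by
  obtain ⟨_, α, β, γ, μ, ν, rfl⟩ := m
  refine ⟨β, -ν, α, μ, γ, ?_⟩
  ext i j
  fin_cases i <;> fin_cases j <;> simp [ospE, ospX, ospH, ospY, ospF]

theorem natS_eq_sum (s : natS F) : ∃ a b c : F, s = a • natSU F + b • natSV F + c • natSW F := by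
  obtain ⟨_, α, μ, ν, rfl⟩ := s
  refine ⟨ν, α, μ, ?_⟩
  ext i j
  fin_cases i <;> fin_cases j <;> simp [natSU, natSV, natSW, mul_comm]

variable {A : Type*} [AddCommGroup A] [Module F A]

theorem osp12_tensor_eq_sum (t : osp12 F ⊗[F] A) : ∃ a b c d e : A, t = ospE F ⊗ₜ[F] a +
    ospX F ⊗ₜ[F] b + ospH F ⊗ₜ[F] c + ospY F ⊗ₜ[F] d + ospF F ⊗ₜ[F] e := by
  induction t with
  | zero => exact ⟨0, 0, 0, 0, 0, by simp⟩
  | tmul m x =>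
    obtain ⟨a, b, c, d, e, rfl⟩ := osp12_eq_sum m
    exact ⟨a • x, b • x, c • x, d • x, e • x, by
      simp only [TensorProduct.add_tmul, TensorProduct.smul_tmul]⟩
  | add t t' h h' =>
    obtain ⟨a, b, c, d, e, rfl⟩ := h
    obtain ⟨a', b', c', d', e', rfl⟩ := h'
    exact ⟨a + a', b + b', c + c', d + d', e + e', by simp only [TensorProduct.tmul_add]; abel⟩

theorem natS_tensor_eq_sum (t : natS F ⊗[F] A) : ∃ a b c : A, t = natSU F ⊗ₜ[F] a +
    natSV F ⊗ₜ[F] b + natSW F ⊗ₜ[F] c := by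
  induction t with
  | zero => exact ⟨0, 0, 0, by simp⟩
  | tmul m x =>
    obtain ⟨a, b, c, rfl⟩ := natS_eq_sum m
    exact ⟨a • x, b • x, c • x, by
      simp only [TensorProduct.add_tmul, TensorProduct.smul_tmul]⟩
  | add t t' h h' =>
    obtain ⟨a, b, c, rfl⟩ := h
    obtain ⟨a', b', c', rfl⟩ := h'
    exact ⟨a + a', b + b', c + c', by simp only [TensorProduct.tmul_add]; abel⟩

end Bases

namespace B01Embedding

variable {F : Type u} [Field F] {g : Type v} [AddCommGroup g] [Module F g]
  {L : LieSuperalgebra F g} {ι : B01Embedding L}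

/-! ### The isotypic decomposition -/

variable (ι) in
/-- The space of parity preserving homomorphisms of modules from a subspace of `gl(1,2)`. -/
def intertwiners (S : Submodule F (Matrix (Fin 3) (Fin 3) F)) : Submodule F (S →ₗ[F] g) where
  carrier := {f | ι.IsIntertwiner f}
  zero_mem' := ⟨fun _ _ _ => zero_mem _, fun _ _ _ _ => by simp⟩
  add_mem' := fun {f f'} hf hf' => ⟨fun i s hs => add_mem (hf.1 i s hs) (hf'.1 i s hs),
    fun m s t h => by simp [hf.2 m s t h, hf'.2 m s t h]⟩
  smul_mem' := fun c f hf => ⟨fun i s hs => Submodule.smul_mem _ c (hf.1 i s hs),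
    fun m s t h => by simp [hf.2 m s t h]⟩

/-- E generates the adjoint module: up to invertible scalars, ad F takes E to H and H to F, ad Y
takes E to X, and ad F takes X to Y. -/
theorem IsIntertwiner.eq_of_ospE {f f' : osp12 F →ₗ[F] g} (h2 : (2 : F) ≠ 0)
    (hf : ι.IsIntertwiner f) (hf' : ι.IsIntertwiner f') (h : f (ospE F) = f' (ospE F)) :
    f = f' := by
  have step : ∀ (m s t : osp12 F) (c : F), c ≠ 0 → c • t.1 = (gl12 F).bracket m.1 s.1 →
      f s = f' s → f t = f' t := fun m s t c hc e hs => by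
    have e1 := hf.bracket_eq m s c t e
    rw [hs, hf'.bracket_eq m s c t e] at e1
    exact (smul_right_injective g hc e1).symm
  have hH := step (ospF F) (ospE F) (ospH F) (-1) (neg_ne_zero.2 one_ne_zero) (by
    rw [gl_bracket_ospF]
    ext i j; fin_cases i <;> fin_cases j <;> simp [ospE, ospH]) h
  have hF := step (ospF F) (ospH F) (ospF F) 2 h2 (by
    rw [gl_bracket_ospF]
    ext i j; fin_cases i <;> fin_cases j <;> simp [ospF, ospH]; norm_num) hH
  have hX := step (ospY F) (ospE F) (ospX F) (-1) (neg_ne_zero.2 one_ne_zero) (by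
    rw [gl_bracket_ospY]
    ext i j; fin_cases i <;> fin_cases j <;> simp [ospE, ospX]) h
  have hY := step (ospF F) (ospX F) (ospY F) 1 one_ne_zero (by
    rw [gl_bracket_ospF]
    ext i j; fin_cases i <;> fin_cases j <;> simp [ospX, ospY]) hX
  ext m
  obtain ⟨a, b, c, d, e, rfl⟩ := osp12_eq_sum m
  simp only [map_add, map_smul, h, hH, hF, hX, hY]

theorem IsIntertwiner.eq_zero_of_natSU {f : natS F →ₗ[F] g} (hf : ι.IsIntertwiner f)
    (h : f (natSU F) = 0) : f = 0 := by
  have hW := hf.bracket_eq (ospF F) (natSU F) (-1) (natSW F) (by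
    rw [gl_bracket_ospF]
    ext i j; fin_cases i <;> fin_cases j <;> simp [natSU, natSW])
  have hV := hf.bracket_eq (ospY F) (natSU F) 1 (natSV F) (by
    rw [gl_bracket_ospY]
    ext i j; fin_cases i <;> fin_cases j <;> simp [natSU, natSV]; norm_num)
  rw [h, map_zero] at hV hW
  ext s
  obtain ⟨a, b, c, rfl⟩ := natS_eq_sum s
  simp only [map_add, map_smul, h, LinearMap.zero_apply]
  linear_combination (norm := module) c • hW - b • hV

section Independence

variable {f : osp12 F →ₗ[F] g} {f' : natS F →ₗ[F] g} (hf : ι.IsIntertwiner f)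
  (hf' : ι.IsIntertwiner f') (h2 : (2 : F) ≠ 0)
include hf h2

theorem IsIntertwiner.eq_zero_of_ospE (h : f (ospE F) = 0) : f = 0 :=
  hf.eq_of_ospE h2 (ι.intertwiners _).zero_mem h

include hf'

/-- The operator ad X separates the two modules: it kills the vector of weight 1 of s and sends X to
-2E. In the weights 0 and -1 below it raises the weight by one, which reduces those cases to this
one. -/
theorem IsIntertwiner.eq_zero_of_weight_one (h : f (ospX F) + f' (natSU F) = 0) :
    f = 0 ∧ f' = 0 := by
  have e := congrArg (L.bracket (ι.toLin (ospX F))) h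
  rw [map_add, hf.bracket_eq (ospX F) (ospX F) (-2) (ospE F), hf'.bracket_eq (ospX F) (natSU F) 0 0,
    zero_smul, add_zero, map_zero] at e
  · have h0 := hf.eq_zero_of_ospE h2 ((smul_eq_zero.1 e).resolve_left (neg_ne_zero.2 h2))
    rw [h0, LinearMap.zero_apply, zero_add] at h
    exact ⟨h0, hf'.eq_zero_of_natSU h⟩
  · rw [gl_bracket_ospX]
    ext i j; fin_cases i <;> fin_cases j <;> simp [natSU]
  · rw [gl_bracket_ospX]
    ext i j; fin_cases i <;> fin_cases j <;> simp [ospX, ospE]; norm_num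

theorem IsIntertwiner.eq_zero_of_weight_zero {d : g} (hd : d ∈ ι.centralizer)
    (h : f (ospH F) + f' (natSV F) + d = 0) : f = 0 ∧ f' = 0 := by
  have e := congrArg (L.bracket (ι.toLin (ospX F))) h
  rw [map_add, map_add, hf.bracket_eq (ospX F) (ospH F) (-1) (ospX F),
    hf'.bracket_eq (ospX F) (natSV F) 1 (natSU F), one_smul, hd (ospX F), add_zero, map_zero,
    neg_one_smul, ← LinearMap.neg_apply] at e
  · have := IsIntertwiner.eq_zero_of_weight_one ((ι.intertwiners _).neg_mem hf) hf' h2 e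
    rwa [neg_eq_zero] at this
  · rw [gl_bracket_ospX]
    ext i j; fin_cases i <;> fin_cases j <;> simp [natSU, natSV] <;> norm_num
  · rw [gl_bracket_ospX]
    ext i j; fin_cases i <;> fin_cases j <;> simp [ospX, ospH]

theorem IsIntertwiner.eq_zero_of_weight_neg_one (h : f (ospY F) + f' (natSW F) = 0) :
    f = 0 ∧ f' = 0 := by
  have e := congrArg (L.bracket (ι.toLin (ospX F))) h
  rw [map_add, hf.bracket_eq (ospX F) (ospY F) 1 (ospH F),
    hf'.bracket_eq (ospX F) (natSW F) 1 (natSV F), one_smul, one_smul, map_zero] at e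
  · exact hf.eq_zero_of_weight_zero hf' h2 ι.centralizer.zero_mem (by rw [e, add_zero])
  · rw [gl_bracket_ospX]
    ext i j; fin_cases i <;> fin_cases j <;> simp [natSW, natSV]; norm_num
  · rw [gl_bracket_ospX]
    ext i j; fin_cases i <;> fin_cases j <;> simp [ospY, ospH]

end Independence

theorem IsIntertwiner.eq_zero_of_ospF {f : osp12 F →ₗ[F] g} (hf : ι.IsIntertwiner f)
    (h2 : (2 : F) ≠ 0) (h : f (ospF F) = 0) : f = 0 := by
  have e := congrArg (L.bracket (ι.toLin (ospE F))) h
  rw [hf.bracket_eq (ospE F) (ospF F) 1 (ospH F), one_smul, map_zero] at e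
  · exact (hf.eq_zero_of_weight_zero (ι.intertwiners (natS F)).zero_mem h2 ι.centralizer.zero_mem
      (by simp [e])).1
  · rw [gl_bracket_ospE]
    ext i j; fin_cases i <;> fin_cases j <;> simp [ospF, ospH]

/-- Vectors of different weights for `h` are independent. -/
theorem weight_vectors_eq_zero (h2 : (2 : F) ≠ 0) (h3 : (3 : F) ≠ 0) {h : Module.End F g}
    {p q r s t : g} (hp : h p = (2 : F) • p) (hq : h q = q) (hr : h r = 0) (hs : h s = -s)
    (ht : h t = (-2 : F) • t) (e : p + q + r + s + t = 0) :
    p = 0 ∧ q = 0 ∧ r = 0 ∧ s = 0 ∧ t = 0 := by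
  have h6 : (6 : F) ≠ 0 := by rw [show (6 : F) = 2 * 3 by norm_num]; exact mul_ne_zero h2 h3
  have h24 : (24 : F) ≠ 0 := by
    rw [show (24 : F) = 2 * 2 * 6 by norm_num]
    exact mul_ne_zero (mul_ne_zero h2 h2) h6
  have e1 := congrArg h e
  have e2 := congrArg h e1
  have e3 := congrArg h e2
  have e4 := congrArg h e3
  simp only [map_add, map_neg, map_smul, map_zero, hp, hq, hr, hs, ht] at e1 e2 e3 e4
  have cancel : ∀ (c : F) (x : g), c ≠ 0 → c • x = 0 → x = 0 :=
    fun c x hc hx => (smul_eq_zero.1 hx).resolve_left hc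
  -- Each combination applies to the sum the interpolation polynomial in `h` that isolates one
  -- weight.
  have hp0 : p = 0 := cancel 24 p h24
    (by linear_combination (norm := module) e4 + (2 : F) • e3 - e2 - (2 : F) • e1)
  have ht0 : t = 0 := cancel 24 t h24
    (by linear_combination (norm := module) e4 - (2 : F) • e3 - e2 + (2 : F) • e1)
  have hq0 : q = 0 := cancel 6 q h6
    (by linear_combination (norm := module) -e4 - e3 + (4 : F) • e2 + (4 : F) • e1)
  have hs0 : s = 0 := cancel 6 s h6
    (by linear_combination (norm := module) -e4 + e3 + (4 : F) • e2 - (4 : F) • e1)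
  rw [hp0, hq0, hs0, ht0] at e
  exact ⟨hp0, hq0, by simpa using e, hs0, ht0⟩

variable (ι) in
/-- The evaluation map on homomorphisms. -/
def evaluation (S : Submodule F (Matrix (Fin 3) (Fin 3) F)) :
    S ⊗[F] ι.intertwiners S →ₗ[F] g :=
  TensorProduct.lift (ι.intertwiners S).subtype.flip

theorem evaluation_tmul (S : Submodule F (Matrix (Fin 3) (Fin 3) F)) (s : S)
    (f : ι.intertwiners S) : ι.evaluation S (s ⊗ₜ f) = f.1 s := rfl

variable (ι) in
/-- The sum of the evaluation maps and of the inclusion of the centralizer. -/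
def evaluationSum : ((osp12 F ⊗[F] ι.intertwiners (osp12 F)) ×
    (natS F ⊗[F] ι.intertwiners (natS F)) × ι.centralizer) →ₗ[F] g :=
  (ι.evaluation _).coprod ((ι.evaluation _).coprod ι.centralizer.subtype)

/-- An element of the kernel, written in weight bases of osp(1,2) and s, has five weight components
that vanish separately. Each involves at most one homomorphism of each kind and an element of the
centralizer, so the independence lemmas apply. -/
theorem evaluationSum_injective (h2 : (2 : F) ≠ 0) (h3 : (3 : F) ≠ 0) :
    Function.Injective ι.evaluationSum := by
  rw [injective_iff_map_eq_zero]
  rintro ⟨x, y, d⟩ h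
  obtain ⟨a, b, c, p, q, rfl⟩ := osp12_tensor_eq_sum x
  obtain ⟨r, s, t, rfl⟩ := natS_tensor_eq_sum y
  simp only [evaluationSum, LinearMap.coprod_apply, map_add, evaluation_tmul,
    Submodule.subtype_apply] at h
  have weights : ∀ (S : Submodule F (Matrix (Fin 3) (Fin 3) F)) (f : ι.intertwiners S) (s : S)
      (k : F), k • s.1 = !![0, -s.1 0 1, s.1 0 2; s.1 1 0, 0, 2 * s.1 1 2;
        -s.1 2 0, -2 * s.1 2 1, 0] → L.bracket (ι.toLin (ospH F)) (f.1 s) = k • f.1 s :=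
    fun S f s k hk => f.2.bracket_eq (ospH F) s k s (by rw [hk, gl_bracket_ospH])
  have hE := weights _ a (ospE F) 2 (by
    ext i j; fin_cases i <;> fin_cases j <;> simp [ospE])
  have hX := weights _ b (ospX F) 1 (by
    ext i j; fin_cases i <;> fin_cases j <;> simp [ospX])
  have hH := weights _ c (ospH F) 0 (by
    ext i j; fin_cases i <;> fin_cases j <;> simp [ospH])
  have hY := weights _ p (ospY F) (-1) (by
    ext i j; fin_cases i <;> fin_cases j <;> simp [ospY])
  have hF := weights _ q (ospF F) (-2) (by
    ext i j; fin_cases i <;> fin_cases j <;> simp [ospF])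
  have hU := weights _ r (natSU F) 1 (by
    ext i j; fin_cases i <;> fin_cases j <;> simp [natSU])
  have hV := weights _ s (natSV F) 0 (by
    ext i j; fin_cases i <;> fin_cases j <;> simp [natSV])
  have hW := weights _ t (natSW F) (-1) (by
    ext i j; fin_cases i <;> fin_cases j <;> simp [natSW])
  obtain ⟨e2, e1, e0, e3, e4⟩ := weight_vectors_eq_zero h2 h3
    (h := L.bracket (ι.toLin (ospH F))) (p := a.1 (ospE F)) (q := b.1 (ospX F) + r.1 (natSU F))
    (r := c.1 (ospH F) + s.1 (natSV F) + d.1) (s := p.1 (ospY F) + t.1 (natSW F))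
    (t := q.1 (ospF F)) hE (by rw [map_add, hX, hU]; module)
    (by rw [map_add, map_add, hH, hV, d.2 (ospH F)]; module) (by rw [map_add, hY, hW]; module) hF
    (by rw [← h]; abel)
  have ha : a = 0 := Subtype.ext (IsIntertwiner.eq_zero_of_ospE a.2 h2 e2)
  have hq : q = 0 := Subtype.ext (IsIntertwiner.eq_zero_of_ospF q.2 h2 e4)
  have hb := IsIntertwiner.eq_zero_of_weight_one b.2 r.2 h2 e1
  have hc := IsIntertwiner.eq_zero_of_weight_zero c.2 s.2 h2 d.2 e0
  have hp := IsIntertwiner.eq_zero_of_weight_neg_one p.2 t.2 h2 e3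
  have hd : d = 0 := Subtype.ext (by simpa [hc.1, hc.2] using e0)
  rw [ha, hq, hd, Subtype.ext (a2 := (0 : ι.intertwiners _)) hb.1,
    Subtype.ext (a2 := (0 : ι.intertwiners _)) hb.2,
    Subtype.ext (a2 := (0 : ι.intertwiners _)) hc.1,
    Subtype.ext (a2 := (0 : ι.intertwiners _)) hc.2,
    Subtype.ext (a2 := (0 : ι.intertwiners _)) hp.1,
    Subtype.ext (a2 := (0 : ι.intertwiners _)) hp.2]
  simp

theorem IsStrictGrading.evaluationSum_surjective (hg : ι.IsStrictGrading) :
    Function.Surjective ι.evaluationSum := by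
  intro z
  induction z using hg.induction_summands with
  | hadd x y hx hy =>
    obtain ⟨x, rfl⟩ := hx
    obtain ⟨y, rfl⟩ := hy
    exact ⟨x + y, map_add _ _ _⟩
  | hf f hf s => exact ⟨(s ⊗ₜ ⟨f, hf⟩, 0, 0), by simp [evaluationSum, evaluation_tmul]⟩
  | hf' f hf s => exact ⟨(0, s ⊗ₜ ⟨f, hf⟩, 0), by simp [evaluationSum, evaluation_tmul]⟩
  | hd d hd => exact ⟨(0, 0, ⟨d, hd⟩), by simp [evaluationSum]⟩

/-- The decomposition of a strictly graded superalgebra by means of spaces of homomorphisms. -/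
noncomputable def IsStrictGrading.decomposition (hg : ι.IsStrictGrading) (h2 : (2 : F) ≠ 0)
    (h3 : (3 : F) ≠ 0) :
    ι.Decomposition (ι.intertwiners (osp12 F)) (ι.intertwiners (natS F)) where
  equiv := LinearEquiv.ofBijective ι.evaluationSum
    ⟨evaluationSum_injective h2 h3, hg.evaluationSum_surjective⟩
  adj_parity i m hm f := by
    simpa [evaluationSum, evaluation_tmul] using f.2.1 i m hm
  adj_bracket m x f := by
    simpa [evaluationSum, evaluation_tmul] using (f.2.2 m x _ rfl).symm
  nat_parity i s hs f := by
    simpa [evaluationSum, evaluation_tmul] using f.2.1 i s hs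
  nat_bracket m s f := by
    simpa [evaluationSum, evaluation_tmul] using (f.2.2 m s _ rfl).symm
  triv d := by simp [evaluationSum]

/-! ### Arbitrary decompositions -/

namespace Decomposition

variable {A : Type a} {B : Type b} [AddCommGroup A] [Module F A] [AddCommGroup B] [Module F B]
  (T : ι.Decomposition A B)

/-- The homomorphism `m ↦ m ⊗ x`. -/
def adjHom (x : A) : osp12 F →ₗ[F] g :=
  T.equiv.toLinearMap ∘ₗ LinearMap.inl F _ _ ∘ₗ (TensorProduct.mk F _ _).flip x

/-- The homomorphism `s ↦ s ⊗ x`. -/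
def natHom (x : B) : natS F →ₗ[F] g :=
  T.equiv.toLinearMap ∘ₗ LinearMap.inr F _ _ ∘ₗ LinearMap.inl F _ _ ∘ₗ
    (TensorProduct.mk F _ _).flip x

theorem adjHom_apply (x : A) (m : osp12 F) : T.adjHom x m = T.equiv (m ⊗ₜ x, 0, 0) := rfl

theorem natHom_apply (x : B) (s : natS F) : T.natHom x s = T.equiv (0, s ⊗ₜ x, 0) := rfl

theorem adjHom_isIntertwiner (x : A) : ι.IsIntertwiner (T.adjHom x) :=
  (isIntertwiner_iff_isAdjointHom _).2
    ⟨fun i m hm => T.adj_parity i m hm x, fun m y => (T.adj_bracket m y x).symm⟩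

theorem natHom_isIntertwiner (x : B) : ι.IsIntertwiner (T.natHom x) :=
  ⟨fun i s hs => T.nat_parity i s hs x, fun m s t h => by
    rw [natHom_apply, natHom_apply, T.nat_bracket]
    congr 4
    exact Subtype.ext h⟩

/-- Homomorphisms of modules intertwine the Weyl elements, so on m ⊗ a and s ⊗ b the Weyl element
acts on the first factor only, where it is Φ; on the centralizer it is the identity. -/
theorem phi_eq_weyl (h2 : (2 : F) ≠ 0) : T.phi = ι.weyl := by
  have key : T.phi ∘ₗ T.equiv.toLinearMap = ι.weyl ∘ₗ T.equiv.toLinearMap := by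
    refine LinearMap.prod_ext ?_ (LinearMap.prod_ext ?_ ?_)
    · refine TensorProduct.ext' fun m x => ?_
      change T.phi (T.equiv (m ⊗ₜ x, 0, 0)) = ι.weyl (T.equiv (m ⊗ₜ x, 0, 0))
      rw [← T.adjHom_apply, (T.adjHom_isIntertwiner x).weyl osp12_stable,
        show ospWeyl osp12_stable m = phiOsp F m from Subtype.ext (coe_ospWeyl _ h2 m),
        T.adjHom_apply, T.adjHom_apply]
      simp [phi]
    · refine TensorProduct.ext' fun s x => ?_
      change T.phi (T.equiv (0, s ⊗ₜ x, 0)) = ι.weyl (T.equiv (0, s ⊗ₜ x, 0))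
      rw [← T.natHom_apply, (T.natHom_isIntertwiner x).weyl natS_stable,
        show ospWeyl natS_stable s = phiNatS F s from Subtype.ext (coe_ospWeyl _ h2 s),
        T.natHom_apply, T.natHom_apply]
      simp [phi]
    · ext d
      change T.phi (T.equiv (0, 0, d)) = ι.weyl (T.equiv (0, 0, d))
      rw [T.triv, weyl_of_mem_centralizer d.2, ← T.triv d]
      simp [phi]
  ext z
  simpa using LinearMap.congr_fun key (T.equiv.symm z)

/-- (ad E)² kills s and the centralizer, and on osp(1,2) it sends F to -2E and the other weight
vectors to zero. It thus isolates an element of `A`. -/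
theorem exists_bracket_ospE_ospE (z : g) : ∃ x : A, L.bracket (ι.toLin (ospE F))
    (L.bracket (ι.toLin (ospE F)) z) = T.equiv (ospE F ⊗ₜ x, 0, 0) := by
  obtain ⟨⟨p, q, d⟩, rfl⟩ := T.equiv.surjective z
  have h0 : T.equiv (0, 0, 0) = 0 := map_zero T.equiv
  have hp : ∃ x : A, L.bracket (ι.toLin (ospE F)) (L.bracket (ι.toLin (ospE F))
      (T.equiv (p, 0, 0))) = T.equiv (ospE F ⊗ₜ x, 0, 0) := by
    induction p with
    | zero => exact ⟨0, by rw [TensorProduct.tmul_zero, h0, map_zero, map_zero]⟩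
    | tmul m x =>
      refine ⟨(-2 * m.1 2 1) • x, ?_⟩
      have hf := T.adjHom_isIntertwiner x
      rw [← T.adjHom_apply, ← T.adjHom_apply, hf.bracket osp12_stable,
        hf.bracket_eq (ospE F) (ospAct osp12_stable (ospE F) m) (-2 * m.1 2 1) (ospE F),
        T.adjHom_apply, T.adjHom_apply, ← map_smul, Prod.smul_mk, Prod.smul_mk,
        TensorProduct.tmul_smul, smul_zero, smul_zero]
      rw [coe_ospAct, gl_bracket_ospE, gl_bracket_ospE]
      ext i j; fin_cases i <;> fin_cases j <;> simp [ospE]; ring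
    | add p p' h h' =>
      obtain ⟨x, hx⟩ := h
      obtain ⟨x', hx'⟩ := h'
      refine ⟨x + x', ?_⟩
      have e : ∀ r r' : osp12 F ⊗[F] A, T.equiv (r + r', 0, 0) =
          T.equiv (r, 0, 0) + T.equiv (r', 0, 0) := fun r r' => by rw [← map_add]; simp
      rw [e, map_add, map_add, hx, hx', TensorProduct.tmul_add, e]
  have hq : L.bracket (ι.toLin (ospE F))
    (L.bracket (ι.toLin (ospE F)) (T.equiv (0, q, 0))) = 0 := by
    induction q with
    | zero => rw [h0, map_zero, map_zero]
    | tmul s x =>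
      have hf := T.natHom_isIntertwiner x
      rw [← T.natHom_apply, hf.bracket natS_stable,
        hf.bracket_eq (ospE F) (ospAct natS_stable (ospE F) s) 0 0, zero_smul]
      obtain ⟨_, α, μ, ν, rfl⟩ := s
      rw [coe_ospAct, gl_bracket_ospE, gl_bracket_ospE]
      ext i j; fin_cases i <;> fin_cases j <;> simp
    | add q q' h h' =>
      have e : T.equiv (0, q + q', 0) = T.equiv (0, q, 0) + T.equiv (0, q', 0) := by
        rw [← map_add]; simp
      rw [e, map_add, map_add, h, h', add_zero]
  obtain ⟨x, hx⟩ := hp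
  refine ⟨x, ?_⟩
  have e : T.equiv (p, q, d) = T.equiv (p, 0, 0) + T.equiv (0, q, 0) + T.equiv (0, 0, d) := by
    rw [← map_add, ← map_add]; simp
  rw [e, T.triv, map_add, map_add, d.2 (ospE F), map_add, map_add, hx, hq, map_zero, add_zero,
    add_zero]

/-- As [E, [E, F]] = -2E, the image of E in g has the form E ⊗ 1 with 1 in `A`. The embedding and m
↦ m ⊗ 1 are homomorphisms that agree on E, hence everywhere. -/
theorem exists_toLin_eq (h2 : (2 : F) ≠ 0) :
    ∃ one : A, ∀ m : osp12 F, ι.toLin m = T.equiv (m ⊗ₜ one, 0, 0) := by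
  obtain ⟨x, hx⟩ := T.exists_bracket_ospE_ospE (ι.toLin (ospF F))
  rw [bracket_ospE_ospF, isIntertwiner_toLin.bracket_eq (ospE F) (ospH F) (-2) (ospE F)] at hx
  · have e : ι.toLin (ospE F) = T.adjHom ((-2 : F)⁻¹ • x) (ospE F) := by
      rw [T.adjHom_apply, TensorProduct.tmul_smul]
      have : ((-2 : F)⁻¹ • (ospE F ⊗ₜ[F] x), (0 : natS F ⊗[F] B), (0 : ι.centralizer)) =
        (-2 : F)⁻¹ • (ospE F ⊗ₜ[F] x, 0, 0) := by simp
      rw [this, map_smul, ← hx, smul_smul, inv_mul_cancel₀ (neg_ne_zero.2 h2), one_smul]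
    exact ⟨_, LinearMap.congr_fun
      (isIntertwiner_toLin.eq_of_ospE h2 (T.adjHom_isIntertwiner _) e)⟩
  · rw [gl_bracket_ospE]
    ext i j; fin_cases i <;> fin_cases j <;> simp [ospH, ospE]; norm_num

end Decomposition

theorem IsStrictGrading.weyl_isAutomorphism (hg : ι.IsStrictGrading) (h2 : (2 : F) ≠ 0)
    (h3 : (3 : F) ≠ 0) : L.IsAutomorphism ι.weyl := by
  refine ⟨⟨fun _ _ => weyl_mem_homog, hg.weyl_bracket h2 h3⟩, ?_⟩
  have hE : Function.Bijective (expCube (-L.bracket (ι.toLin (ospE F)))) :=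
    expCube_bijective h2 fun x => by simp [hg.bracket_ospE_cube x]
  exact (hE.comp (expCube_bijective h2 hg.bracket_ospF_cube)).comp hE

end B01Embedding

theorem theorem4p5 {F : Type u} [Field F] (h2 : (2 : F) ≠ 0) (h3 : (3 : F) ≠ 0)
    {g : Type v} [AddCommGroup g] [Module F g] (L : LieSuperalgebra F g)
    (ι : B01Embedding L) (hg : ι.IsStrictGrading) :
    -- `g` decomposes as `(osp(1,2) ⊗ A) ⊕ (s ⊗ B) ⊕ D`
    (∃ (A B : Type (max u v)) (_ : AddCommGroup A) (_ : Module F A) (_ : AddCommGroup B)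
      (_ : Module F B), Nonempty (ι.Decomposition A B)) ∧
    -- the action of `H` gives a `5`-grading
    L.IsFiveGrading ι.grade ∧
    -- for any such decomposition
    ∀ (A : Type a) (B : Type b) [AddCommGroup A] [Module F A] [AddCommGroup B] [Module F B]
      (T : ι.Decomposition A B),
      -- `osp(1,2)` is identified with `osp(1,2) ⊗ 1`
      ∃ one : A, (∀ m : osp12 F, ι.toLin m = T.equiv (m ⊗ₜ[F] one, 0, 0)) ∧
        L.IsAutomorphism T.phi ∧
        -- the product `xyz = [[x, Φ(y)], z]` on `U = g_1`
        ∃ t : ι.grade 1 →ₗ[F] ι.grade 1 →ₗ[F] ι.grade 1 →ₗ[F] ι.grade 1,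
          (∀ x y z : ι.grade 1,
            (t x y z : g) = L.bracket (L.bracket (x : g) (T.phi (y : g))) (z : g)) ∧
          IsFreudenthalKantor (-1) (-1) t ∧
          ∃ e : ι.grade 1, (e : g) = T.equiv (ospX F ⊗ₜ[F] one, 0, 0) ∧
            IsLeftUnit t e ∧ ∀ x : ι.grade 1, t e x e = x := by
  refine ⟨⟨_, _, _, _, _, _, ⟨hg.decomposition h2 h3⟩⟩, hg.isFiveGrading h2 h3,
    fun A B _ _ _ _ T => ?_⟩
  obtain ⟨one, hone⟩ := T.exists_toLin_eq h2
  rw [T.phi_eq_weyl h2]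
  exact ⟨one, hone, hg.weyl_isAutomorphism h2 h3, _,
    LieSuperalgebra.coe_tripleProduct (hg.tripleProduct_mem h2 h3), hg.isFreudenthalKantor h2 h3,
    _, hone (ospX F), hg.isLeftUnit h2 h3, hg.tripleProduct_unit h2 h3⟩
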